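/- Let $n\in\{3,4,5\}$, let $V_5$ be a complex vector space of dimension $5$, let $W\subseteq\bigwedge^2V_5$ be a subspace of dimension $n+5$, let $Q$ be a quadratic form on $\bigwedge^2V_5$, and assume that the scheme $X=\mathrm{Gr}(2,V_5)\cap\mathbf P(W)\cap\{Q=0\}\subseteq\mathbf P(\bigwedge^2V_5)$ is smooth of dimension $n$ (a smooth ordinary Gushel–Mukai variety). Let $\mathcal U_X$ be the restriction to $X$ of the tautological rank-$2$ bundle on $\mathrm{Gr}(2,V_5)$, so that $\mathbf P(\mathcal U_X)$ parametrizes pairs $([v],[V_2])$ with $[V_2]\in X$ and $v\in V_2$, and let $\rho\colon\mathbf P(\mathcal U_X)\to\mathbf P(V_5)$ be the morphism $([v],[V_2])\mapsto[v]$. Let $\Sigma_1(X)\subseteq\mathbf P(V_5)$ be the union of the (one-dimensional) kernels of all nonzero elements of $W^\perp\subseteq\bigwedge^2V_5^\vee$, seen as skew forms on $V_5$; it is empty for $n=5$, a point for $n=4$, and a smooth conic for $n=3$, and as a scheme it is the isomorphic image of $\mathbf P(W^\perp)$ by $[\omega]\mapsto[\operatorname{Ker}\omega]$. Fix an isomorphism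 $\bigwedge^5V_5\simeq\mathbf C$. Set $V_6=V_5\oplus\mathbf Cv_0$, let $Q(\cdot,\cdot)$ be the symmetric bilinear form with $Q(w,w)=Q(w)$, and let $A\subseteq\bigwedge^3V_6$ be the Lagrangian subspace associated with $X$, namely $$A=\{\xi+v_0\wedge w\mid \xi\in\textstyle\bigwedge^3V_5,\ w\in W,\ \xi\wedge w'+Q(w,w')=0\ \text{ for all } w'\in W\}.$$ For $\ell\ge0$, let $Y_A^{\ge\ell}$ be the set of $[v]\in\mathbf P(V_6)$ such that $\dim\bigl(A\cap(v\wedge\bigwedge^2V_6)\bigr)\ge\ell$, and set $Y_A^\ell=Y_A^{\ge\ell}\smallsetminus Y_A^{\ge\ell+1}$ and $Y_A=Y_A^{\ge1}$. For $[v]\in\mathbf P(V_5)$, set $E_v=(v\wedge V_5)\cap W$. The corank of a quadratic form is the dimension of its radical, and the zero form is allowed as the equation of a quadratic hypersurface. The map $\rho$ is surjective, and the following hold. * Over $\mathbf P(V_5)\smallsetminus\Sigma_1(X)$, it is a relative quadratic hypersurface in a $\mathbf P^{n-2}$-fibration: the $E_v$ are the fibers of a vector subbundle $E$ of rank $n-1$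 of the trivial bundle with fiber $\bigwedge^2V_5$, and $([v],[V_2])\mapsto([v],[\bigwedge^2V_2])$ induces an isomorphism of schemes over $\mathbf P(V_5)\smallsetminus\Sigma_1(X)$ from the inverse image by $\rho$ onto the subscheme of $\mathbf P(E)$ of equation $Q|_E=0$. For all $k\ge0$ and all $[v]\in\mathbf P(V_5)\smallsetminus\Sigma_1(X)$, the fiber over $[v]$, that is, the quadric of equation $Q|_{E_v}=0$ in $\mathbf P(E_v)$, has corank $k$ if and only if $[v]\in Y_A^k\cap\mathbf P(V_5)$. * Over $\Sigma_1(X)$, it is a relative quadratic hypersurface in a $\mathbf P^{n-1}$-fibration, in the same sense: the $E_v$ are the fibers of a vector subbundle $E$ of rank $n$, and the inverse image by $\rho$ is isomorphic over $\Sigma_1(X)$, by the same map, to the subscheme of $\mathbf P(E)$ of equation $Q|_E=0$. For all $k\ge0$ and all $[v]\in\Sigma_1(X)$, the fiber over $[v]$ has corank $k$ if and only if $[v]\in Y_A^{k+1}\cap\mathbf P(V_5)$. In particular, $\Sigma_1(X)\subseteq Y_A$. -/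

import Mathlib

open scoped TensorProduct LinearAlgebra.Projectivization

noncomputable section

namespace GM

universe u

/-! ### Multilinear algebra -/

/-- The wedge product `⋀^i V × ⋀^j V → ⋀^(i+j) V`. -/
def wedge (V : Type u) [AddCommGroup V] [Module ℂ V] (i j : ℕ) :
    ⋀[ℂ]^i V →ₗ[ℂ] ⋀[ℂ]^j V →ₗ[ℂ] ⋀[ℂ]^(i + j) V :=
  LinearMap.mk₂ ℂ
    (fun x y => ⟨(x : ExteriorAlgebra ℂ V) * (y : ExteriorAlgebra ℂ V), by
      rw [ExteriorAlgebra.exteriorPower, pow_add]; exact Submodule.mul_mem_mul x.2 y.2⟩)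
    (fun x x' y => Subtype.ext (add_mul _ _ _))
    (fun c x y => Subtype.ext (smul_mul_assoc _ _ _))
    (fun x y y' => Subtype.ext (mul_add _ _ _))
    (fun c x y => Subtype.ext (mul_smul_comm _ _ _))

/-- The wedge product of two vectors, `(u, v) ↦ u ∧ v ∈ ⋀² V`. -/
def wedgeVec (V : Type u) [AddCommGroup V] [Module ℂ V] : V →ₗ[ℂ] V →ₗ[ℂ] ⋀[ℂ]^2 V :=
  LinearMap.mk₂ ℂ
    (fun x y => ⟨ExteriorAlgebra.ι ℂ x * ExteriorAlgebra.ι ℂ y, by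
      rw [ExteriorAlgebra.exteriorPower, pow_two]
      exact Submodule.mul_mem_mul (LinearMap.mem_range_self _ x) (LinearMap.mem_range_self _ y)⟩)
    (fun x x' y => Subtype.ext (by simp [add_mul]))
    (fun c x y => Subtype.ext (by simp))
    (fun x y y' => Subtype.ext (by simp [mul_add]))
    (fun c x y => Subtype.ext (by simp))

/-- The corank of the restriction of the quadratic form `q` to the subspace `N`: the dimension of
the radical of `q|_N`. -/
def corank {M : Type*} [AddCommGroup M] [Module ℂ M] (q : QuadraticForm ℂ M)
    (N : Submodule ℂ M) : ℕ :=
  Module.finrank ℂ ↥(N ⊓ N.orthogonalBilin q.polarBilin)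

/-! ### The variety `X = Gr(2, V) ∩ P(W) ∩ {Q = 0} ⊆ P(⋀² V)` -/

section Smooth

variable {V : Type u} [AddCommGroup V] [Module ℂ V]

/-- The affine cone over `X` is cut out in `W` by the Plücker quadrics (`w ∧ w = 0`) and by `Q`.
This is its Zariski tangent space at `w`, the kernel in `W` of the differentials at `w` of these
equations. -/
def tangentCone (W : Submodule ℂ (⋀[ℂ]^2 V)) (Q : QuadraticForm ℂ (⋀[ℂ]^2 V)) (w : ⋀[ℂ]^2 V) :
    Submodule ℂ (⋀[ℂ]^2 V) :=
  W ⊓ LinearMap.ker (wedge V 2 2 w) ⊓ LinearMap.ker (Q.polarBilin w)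

/-- `X = Gr(2, V) ∩ P(W) ∩ {Q = 0}` is smooth of dimension `n` (Jacobian criterion): at every point
`[w]` of `X` the Zariski tangent space of the scheme `X` has dimension `n`, that is, the tangent
space to the affine cone has dimension `n + 1`. For `dim V = 5` and `dim W = n + 5`, the scheme `X`
has dimension at least `n` at each of its points, and it is nonempty, so that this is equivalent
to `X` being smooth of pure dimension `n`. -/
def IsSmoothOfDim (n : ℕ) (W : Submodule ℂ (⋀[ℂ]^2 V)) (Q : QuadraticForm ℂ (⋀[ℂ]^2 V)) : Prop :=
  ∀ w : ⋀[ℂ]^2 V, w ≠ 0 → w ∈ W → wedge V 2 2 w w = 0 → Q w = 0 →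
    Module.finrank ℂ ↥(tangentCone W Q w) = n + 1

end Smooth

/-! ### Functors of points

All schemes below are of finite type over `ℂ`, and are given by their functors of points on
`ℂ`-algebras `R` of finite type. -/

/-- `N` is an `R`-submodule of `M` with finite projective quotient, and `N` has constant rank `r`.
For `M = R ⊗ T`, with `T` of dimension `d`, these are the `R`-points of the Grassmannian `Gr(r, T)`
(`Module.Grassmannian R M (d - r)`); for `r = 1`, those of `P(T)`. -/
def IsSubbundle {R M : Type*} [CommRing R] [AddCommGroup M] [Module R M] (r : ℕ)
    (N : Submodule R M) : Prop :=
  Module.Finite R (M ⧸ N) ∧ Module.Projective R (M ⧸ N) ∧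
    ∀ p : PrimeSpectrum R, Module.rankAtStalk (R := R) N p = r

/-- The image of a family `N ⊆ R ⊗ T` by a change of rings `R → S`. -/
def pullback {R S : Type*} [CommRing R] [Algebra ℂ R] [CommRing S] [Algebra ℂ S]
    {T : Type u} [AddCommGroup T] [Module ℂ T] (f : R →ₐ[ℂ] S) (N : Submodule R (R ⊗[ℂ] T)) :
    Submodule S (S ⊗[ℂ] T) :=
  Submodule.span S ((LinearMap.rTensor T f.toLinearMap) '' (N : Set (R ⊗[ℂ] T)))

/-- The `ℂ`-point of the functor `P(T)` that corresponds to `p ∈ P(T)`. -/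
def closedPoint {T : Type u} [AddCommGroup T] [Module ℂ T] (p : ℙ ℂ T) :
    Submodule ℂ (ℂ ⊗[ℂ] T) :=
  p.submodule.baseChange ℂ

section Families

variable {V : Type u} [AddCommGroup V] [Module ℂ V]

/-- For `R`-submodules `N`, `N'` of `R ⊗ V`, the submodule `N ∧ N'` of `R ⊗ ⋀² V`, spanned by all
`a ∧ b` with `a ∈ N` and `b ∈ N'`. -/
def wedgeSub (R : Type) [CommRing R] [Algebra ℂ R] (N N' : Submodule R (R ⊗[ℂ] V)) :
    Submodule R (R ⊗[ℂ] ⋀[ℂ]^2 V) :=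
  Submodule.map₂ (LinearMap.BilinMap.baseChange R (wedgeVec V)) N N'

/-- The `R`-points of `X`: the rank-2 subbundles `U` of `R ⊗ V` such that `⋀² U` is contained
in `W` and `Q` vanishes on it. -/
def GMPoints (W : Submodule ℂ (⋀[ℂ]^2 V)) (Q : QuadraticForm ℂ (⋀[ℂ]^2 V))
    (R : Type) [CommRing R] [Algebra ℂ R] : Set (Submodule R (R ⊗[ℂ] V)) :=
  {U | IsSubbundle 2 U ∧ wedgeSub R U U ≤ W.baseChange R ∧
    ∀ m ∈ wedgeSub R U U, Q.baseChange R m = 0}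

/-- The `R`-points of `P(𝒰_X)`, where `𝒰_X` is the restriction to `X` of the tautological rank-2
bundle: the pairs `(L, U)` where `U` is an `R`-point of `X` and `L ⊆ U` a rank-1 subbundle. -/
def PUPoints (W : Submodule ℂ (⋀[ℂ]^2 V)) (Q : QuadraticForm ℂ (⋀[ℂ]^2 V))
    (R : Type) [CommRing R] [Algebra ℂ R] :
    Set (Submodule R (R ⊗[ℂ] V) × Submodule R (R ⊗[ℂ] V)) :=
  {x | IsSubbundle 1 x.1 ∧ x.1 ≤ x.2 ∧ x.2 ∈ GMPoints W Q R}

/-- The map `ρ : P(𝒰_X) → P(V)`, `(L, U) ↦ L`, on `R`-points. -/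
def rho {R : Type} [CommRing R] [Algebra ℂ R]
    (x : Submodule R (R ⊗[ℂ] V) × Submodule R (R ⊗[ℂ] V)) : Submodule R (R ⊗[ℂ] V) :=
  x.1

/-- The `R`-points of `Σ₁(X) ⊆ P(V)`, the locus of the kernels of the nonzero elements of
`W^⊥ ⊆ (⋀² V)^∨`: a line bundle `L ⊆ R ⊗ V` is in `Σ₁(X)` if there is an `R`-point `D` of `P(W^⊥)`
such that `L` is in the kernel of all the skew forms in `D`, that is, these vanish
on `L ∧ (R ⊗ V)`. For `R = ℂ`, this says that `L` is in the kernel of some nonzero `ω ∈ W^⊥`. -/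
def Sigma1 (W : Submodule ℂ (⋀[ℂ]^2 V)) (R : Type) [CommRing R] [Algebra ℂ R] :
    Set (Submodule R (R ⊗[ℂ] V)) :=
  {L | IsSubbundle 1 L ∧
    ∃ D : Submodule R (Module.Dual R (R ⊗[ℂ] ⋀[ℂ]^2 V)), IsSubbundle 1 D ∧
      D ≤ (W.baseChange R).dualAnnihilator ∧ D ≤ (wedgeSub R L ⊤).dualAnnihilator}

/-- The `R`-points of the open complement `P(V) ∖ Σ₁(X)`: the `R`-points of `P(V)` that, at every
`ℂ`-point of `Spec R`, take a value outside of `Σ₁(X)`. -/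
def Sigma1Compl (W : Submodule ℂ (⋀[ℂ]^2 V)) (R : Type) [CommRing R] [Algebra ℂ R] :
    Set (Submodule R (R ⊗[ℂ] V)) :=
  {L | IsSubbundle 1 L ∧ ∀ x : R →ₐ[ℂ] ℂ, pullback x L ∉ Sigma1 W ℂ}

/-- The family of subspaces `(v ∧ V) ∩ W` of `⋀² V`, for `[v] ∈ P(V)`, over `R`-points. -/
def wedgeBundle (W : Submodule ℂ (⋀[ℂ]^2 V)) (R : Type) [CommRing R] [Algebra ℂ R]
    (L : Submodule R (R ⊗[ℂ] V)) : Submodule R (R ⊗[ℂ] ⋀[ℂ]^2 V) :=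
  wedgeSub R L ⊤ ⊓ W.baseChange R

/-- Let `B` be a subscheme of `P(V)`, let `P` be a scheme of pairs `(L, U)` with its projection
`(L, U) ↦ L` to `P(V)`, let `E` be a family of submodules of the trivial bundle with fiber `T`, let
`q` be a quadratic form on `T`, and let `Φ` be a map from families `U` to submodules of the trivial
bundle with fiber `T`. This predicate says that

* `E` is over `B` a vector subbundle of rank `m + 1` of the trivial bundle `T ⊗ 𝒪_B`, so that
  `P(E) → B` is a `P^m`-fibration;
* `(L, U) ↦ Φ(U)` is an isomorphism of `B`-schemes (a natural bijection on `R`-points over `B`)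
  from `P ×_{P(V)} B` to the relative quadratic hypersurface in `P(E)` of equation `q = 0`. -/
structure IsRelativeQuadric {T : Type u} [AddCommGroup T] [Module ℂ T]
    (B : (R : Type) → [CommRing R] → [Algebra ℂ R] → Set (Submodule R (R ⊗[ℂ] V)))
    (P : (R : Type) → [CommRing R] → [Algebra ℂ R] →
      Set (Submodule R (R ⊗[ℂ] V) × Submodule R (R ⊗[ℂ] V)))
    (m : ℕ)
    (E : (R : Type) → [CommRing R] → [Algebra ℂ R] →
      Submodule R (R ⊗[ℂ] V) → Submodule R (R ⊗[ℂ] T))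
    (q : QuadraticForm ℂ T)
    (Φ : (R : Type) → [CommRing R] → [Algebra ℂ R] →
      Submodule R (R ⊗[ℂ] V) → Submodule R (R ⊗[ℂ] T)) : Prop where
  isSubbundle : ∀ (R : Type) [CommRing R] [Algebra ℂ R] [Algebra.FiniteType ℂ R], ∀ L ∈ B R,
    IsSubbundle (m + 1) (E R L)
  isSubbundle_pullback : ∀ (R S : Type) [CommRing R] [Algebra ℂ R] [Algebra.FiniteType ℂ R]
    [CommRing S] [Algebra ℂ S] [Algebra.FiniteType ℂ S] (f : R →ₐ[ℂ] S), ∀ L ∈ B R,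
    E S (pullback f L) = pullback f (E R L)
  bijOn : ∀ (R : Type) [CommRing R] [Algebra ℂ R] [Algebra.FiniteType ℂ R], ∀ L ∈ B R,
    Set.BijOn (fun U => Φ R U) {U | (L, U) ∈ P R}
      {M | IsSubbundle 1 M ∧ M ≤ E R L ∧ ∀ x ∈ M, q.baseChange R x = 0}
  bijOn_pullback : ∀ (R S : Type) [CommRing R] [Algebra ℂ R] [Algebra.FiniteType ℂ R]
    [CommRing S] [Algebra ℂ S] [Algebra.FiniteType ℂ S] (f : R →ₐ[ℂ] S), ∀ L ∈ B R,
    ∀ U, (L, U) ∈ P R → Φ S (pullback f U) = pullback f (Φ R U)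

end Families

/-! ### The associated Lagrangian and its EPW strata -/

section Lagrangian

variable {V : Type u} [AddCommGroup V] [Module ℂ V]

/-- The pairs `(ξ, w)`, with `ξ ∈ ⋀³ V` and `w ∈ W`, such that `ξ ∧ w' + Q(w, w') = 0` for all
`w' ∈ W`, where `⋀⁵ V` is identified with `ℂ` by `vol` and `Q( , )` is the symmetric bilinear form
with `Q(w, w) = Q(w)`. -/
def lagrangianPairs (W : Submodule ℂ (⋀[ℂ]^2 V)) (Q : QuadraticForm ℂ (⋀[ℂ]^2 V))
    (vol : ⋀[ℂ]^5 V ≃ₗ[ℂ] ℂ) : Submodule ℂ (⋀[ℂ]^3 V × ⋀[ℂ]^2 V) where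
  carrier := {x | x.2 ∈ W ∧
    ∀ w' ∈ W, vol (wedge V 3 2 x.1 w') + QuadraticMap.associated (R := ℂ) Q x.2 w' = 0}
  zero_mem' := ⟨W.zero_mem, fun w' _ => by simp⟩
  add_mem' := by
    rintro x y ⟨hx, hx'⟩ ⟨hy, hy'⟩
    refine ⟨W.add_mem hx hy, fun w' hw' => ?_⟩
    have h1 := hx' w' hw'
    have h2 := hy' w' hw'
    simp only [Prod.fst_add, Prod.snd_add, map_add, LinearMap.add_apply] at *
    linear_combination h1 + h2
  smul_mem' := by
    rintro c x ⟨hx, hx'⟩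
    refine ⟨W.smul_mem c hx, fun w' hw' => ?_⟩
    have h1 := hx' w' hw'
    simp only [Prod.smul_fst, Prod.smul_snd, map_smul, LinearMap.smul_apply, smul_eq_mul] at *
    linear_combination c * h1

/-- The Lagrangian subspace `A ⊆ ⋀³ V₆` associated with `X`, where `V₆ = V ⊕ ℂ v₀` is (identified
with) the space of quadrics containing `X`, the hyperplane `V` being the space of Plücker quadrics
and `v₀` corresponding to `Q`: the set of all `ξ + v₀ ∧ w` with `(ξ, w)` as above. -/
def lagrangian (W : Submodule ℂ (⋀[ℂ]^2 V)) (Q : QuadraticForm ℂ (⋀[ℂ]^2 V))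
    (vol : ⋀[ℂ]^5 V ≃ₗ[ℂ] ℂ) : Submodule ℂ (ExteriorAlgebra ℂ (V × ℂ)) :=
  let incl (i : ℕ) : ⋀[ℂ]^i V →ₗ[ℂ] ExteriorAlgebra ℂ (V × ℂ) :=
    (ExteriorAlgebra.map (LinearMap.inl ℂ V ℂ)).toLinearMap ∘ₗ (⋀[ℂ]^i V).subtype
  let v₀ : V × ℂ := (0, 1)
  (lagrangianPairs W Q vol).map
    ((incl 3).coprod (LinearMap.mulLeft ℂ (ExteriorAlgebra.ι ℂ v₀) ∘ₗ incl 2))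

/-- `Y_A^{≥ ℓ} = {[v] ∈ P(V₆) ∣ dim (A ∩ (v ∧ ⋀² V₆)) ≥ ℓ}`. -/
def YGe {V₆ : Type u} [AddCommGroup V₆] [Module ℂ V₆]
    (A : Submodule ℂ (ExteriorAlgebra ℂ V₆)) (l : ℕ) : Set (ℙ ℂ V₆) :=
  {p | l ≤ Module.finrank ℂ ↥(A ⊓ (p.submodule.map (ExteriorAlgebra.ι ℂ) * ⋀[ℂ]^2 V₆))}

/-- `Y_A^ℓ = Y_A^{≥ ℓ} ∖ Y_A^{≥ ℓ + 1}`. -/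
def YEq {V₆ : Type u} [AddCommGroup V₆] [Module ℂ V₆]
    (A : Submodule ℂ (ExteriorAlgebra ℂ V₆)) (l : ℕ) : Set (ℙ ℂ V₆) :=
  YGe A l \ YGe A (l + 1)

/-- The inclusion `P(V) ⊆ P(V₆)`. -/
def hyperplaneIncl (p : ℙ ℂ V) : ℙ ℂ (V × ℂ) :=
  p.map (LinearMap.inl ℂ V ℂ) LinearMap.inl_injective

end Lagrangian

end GM

end

/-!
Write `E_v = (v ∧ V) ∩ W`, where `V = V₅`. A plane containing `v` is `⟨v, u⟩` with `u` unique modulo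
`v` up to a scalar, and is determined by the bivector `v ∧ u`. So the planes containing `v` that
belong to `X` are the points of `P(E_v)` where `Q` vanishes. In families, over an arbitrary base
`R`, a rank-one subbundle of a free module has a frame (`IsLine`) that gives projectors and inverse
maps by explicit formulas with contractions; this yields the bijection `U ↦ ⋀² U` between the
rank-two subbundles containing a line bundle `L` and the rank-one subbundles of `L ∧ V`
(`bijOn_wedgeSub_self`).

The dimension of `E_v` is `dim W + 4 - dim ((v ∧ V) + W)`, and the codimension of `(v ∧ V) + W`
in `⋀² V` is the dimension of the space of forms in `W^⊥` with `v` in their kernel. It is `0` off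
`Σ₁(X)`, by definition, and at least `1` on `Σ₁(X)`. Smoothness of `X` enters only to bound it by
`1` (`finrank_wedge_sup_ge`). The sum `(L ∧ V) + W` is then a subbundle on both strata: by Nakayama's
lemma at the closed points (`le_of_pullback_le`), it is everything off `Σ₁(X)`, and on `Σ₁(X)` it is
the kernel of the line bundle of forms that defines the points of `Σ₁(X)`. Therefore so is the
intersection `E`, with a projector that is compatible with base change (`isProj_inf`).

For the coranks, the elements `ξ + v₀ ∧ w` of `A ∩ (v ∧ ⋀² V₆)` are those with `v ∧ ξ = v ∧ w = 0`
(`sumV₀_mem_iff`), by exactness of the Koszul complex of `v`. The projection to `w` has as its image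
the radical of `Q|_{E_v}`, since a linear form on `⋀² V` that vanishes on `E_v` is the sum of one
that vanishes on `v ∧ V` and one that vanishes on `W`, and since `⋀³ V` is dual to `⋀² V`, with
`{ξ | v ∧ ξ = 0}` the annihilator of `v ∧ V`. Its kernel is the annihilator of `(v ∧ V) + W`. This
gives `dim (A ∩ (v ∧ ⋀² V₆)) = corank (Q|_{E_v}) + codim ((v ∧ V) + W)`
(`finrank_lagrangian_inf_add`).
-/

noncomputable section

namespace GM

universe u

/-! ### Line bundles in a free module -/

section Lines

variable {R M : Type*} [CommRing R] [AddCommGroup M] [Module R M]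

/-- A line in `M`: a submodule `N` with elements `v i` and linear forms `f i` on `M` such that any
two elements of `N` are proportional, in the ratio of their values under each `f i`, and
`∑ i, f i (v i) = 1`. For `M` free of finite rank, these are the direct summands of rank one. The
frame `(v, f)` gives the explicit projector `∑ i, f i • v i` onto `N`, and the condition involves
neither localizations nor quotients. -/
def IsLine (N : Submodule R M) : Prop :=
  ∃ (ι : Type) (_ : Fintype ι) (v : ι → M) (f : ι → Module.Dual R M),
    (∀ i, v i ∈ N) ∧ (∀ i, ∀ n ∈ N, ∀ n' ∈ N, f i n • n' = f i n' • n) ∧ ∑ i, f i (v i) = 1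

lemma sum_smul_eq_self_of_frame {N : Submodule R M} {ι : Type*} [Fintype ι] {v : ι → M}
    {f : ι → Module.Dual R M} (hv : ∀ i, v i ∈ N)
    (hf : ∀ i, ∀ n ∈ N, ∀ n' ∈ N, f i n • n' = f i n' • n) (h1 : ∑ i, f i (v i) = 1)
    {n : M} (hn : n ∈ N) : ∑ i, f i n • v i = n := by
  simp_rw [fun i => hf i n hn (v i) (hv i), ← Finset.sum_smul, h1, one_smul]

lemma IsLine.apply_smul_comm {N : Submodule R M} (hN : IsLine N) (g : Module.Dual R M) {n n' : M}
    (hn : n ∈ N) (hn' : n' ∈ N) : g n • n' = g n' • n := by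
  obtain ⟨ι, _, v, f, hv, hf, h1⟩ := hN
  have key : ∀ {a b : M}, a ∈ N → b ∈ N → g a • b = ∑ i, (f i b * g (v i)) • a := by
    intro a b ha hb
    conv_lhs => rw [← sum_smul_eq_self_of_frame hv hf h1 ha]
    simp only [map_sum, map_smul, smul_eq_mul, Finset.sum_smul]
    refine Finset.sum_congr rfl fun i _ => ?_
    rw [mul_comm, mul_smul, hf i a ha b hb, ← mul_smul, mul_comm]
  rw [key hn hn', ← Finset.sum_smul]
  congr 1
  conv_rhs => rw [← sum_smul_eq_self_of_frame hv hf h1 hn']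
  simp

lemma IsLine.exists_isProj {N : Submodule R M} (hN : IsLine N) :
    ∃ P : M →ₗ[R] M, LinearMap.IsProj N P := by
  obtain ⟨ι, _, v, f, hv, hf, h1⟩ := hN
  refine ⟨∑ i, (f i).smulRight (v i), fun m => ?_, fun n hn => ?_⟩
  · simpa using N.sum_mem fun i _ => N.smul_mem _ (hv i)
  · simpa using sum_smul_eq_self_of_frame hv hf h1 hn

/-- Two elements of a finite projective module of rank one are proportional. -/
lemma smul_comm_of_rankAtStalk_eq_one {N : Type*} [AddCommGroup N] [Module R N] [Module.Finite R N]
    [Module.Projective R N] (h : ∀ p : PrimeSpectrum R, Module.rankAtStalk (R := R) N p = 1)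
    (g : Module.Dual R N) (n n' : N) : g n • n' = g n' • n := by
  refine Module.eq_of_localization_maximal (fun P _ => LocalizedModule.AtPrime P N)
    (fun (P : Ideal R) _ => LocalizedModule.mkLinearMap (Ideal.primeCompl P) N) _ _ fun P hP => ?_
  have hr := h ⟨P, hP.isPrime⟩
  rw [Module.rankAtStalk] at hr
  have : Module.Free (Localization.AtPrime P) (LocalizedModule.AtPrime P N) :=
    Module.free_of_flat_of_isLocalRing
  obtain ⟨b, -, hb⟩ := (finrank_eq_one_iff' (K := Localization.AtPrime P)
    (V := LocalizedModule.AtPrime P N)).1 hr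
  let F := LocalizedModule.mkLinearMap P.primeCompl N
  let G : LocalizedModule.AtPrime P N →ₗ[Localization.AtPrime P] Localization.AtPrime P :=
    (IsLocalizedModule.map P.primeCompl F
      (Algebra.linearMap R (Localization.AtPrime P)) g).extendScalarsOfIsLocalization
        P.primeCompl _
  have hG : ∀ n, G (F n) = algebraMap R _ (g n) := fun n =>
    IsLocalizedModule.map_apply P.primeCompl F (Algebra.linearMap R (Localization.AtPrime P)) g n
  obtain ⟨c, hc⟩ := hb (F n)
  obtain ⟨c', hc'⟩ := hb (F n')
  change F (g n • n') = F (g n' • n)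
  rw [map_smul, map_smul, ← algebraMap_smul (Localization.AtPrime P) (g n) (F n'),
    ← algebraMap_smul (Localization.AtPrime P) (g n') (F n), ← hG, ← hG, ← hc, ← hc']
  simp only [map_smul, smul_smul, smul_eq_mul]
  congr 1
  ring

lemma finite_of_isProj [Module.Finite R M] {N : Submodule R M} {P : M →ₗ[R] M}
    (hP : LinearMap.IsProj N P) : Module.Finite R N :=
  Module.Finite.of_surjective hP.codRestrict fun x => ⟨x, hP.codRestrict_apply_cod x⟩

lemma projective_of_isProj [Module.Projective R M] {N : Submodule R M} {P : M →ₗ[R] M}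
    (hP : LinearMap.IsProj N P) : Module.Projective R N :=
  Module.Projective.of_split N.subtype hP.codRestrict
    (LinearMap.ext fun x => hP.codRestrict_apply_cod x)

/-- A direct summand of rank one is a line: for a basis `b` of `M` and a projector `P` onto it, the
elements `P (b i)` and the coordinate forms are a frame. The sum `t = ∑ i, f i (v i)` is the trace
of `P`, an idempotent that acts as the identity on a module with full support, hence `t = 1`. -/
lemma isLine_of_isProj [Module.Free R M] [Module.Finite R M] {N : Submodule R M}
    {P : M →ₗ[R] M} (hP : LinearMap.IsProj N P)
    (h : ∀ p : PrimeSpectrum R, Module.rankAtStalk (R := R) N p = 1) : IsLine N := by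
  have hfin := finite_of_isProj hP
  have hproj := projective_of_isProj hP
  let b := Module.Free.chooseBasis R M
  let f : Module.Free.ChooseBasisIndex R M → Module.Dual R M := b.coord
  let v : Module.Free.ChooseBasisIndex R M → M := fun i => P (b i)
  have hv : ∀ i, v i ∈ N := fun i => hP.map_mem _
  have hsum : ∀ n ∈ N, ∑ i, f i n • v i = n := fun n hn => by
    have := congrArg P (b.sum_repr n)
    rw [hP.map_id n hn, map_sum] at this
    simp only [map_smul] at this
    exact this
  have hf : ∀ (g : Module.Dual R M), ∀ n ∈ N, ∀ n' ∈ N, g n • n' = g n' • n :=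
    fun g n hn n' hn' => congrArg Subtype.val
      (smul_comm_of_rankAtStalk_eq_one h (g ∘ₗ N.subtype) ⟨n, hn⟩ ⟨n', hn'⟩)
  set t := ∑ i, f i (v i) with ht
  -- The trace of the projector acts on `N` as the identity, and `N` is faithful.
  have htn : ∀ n ∈ N, t • n = n := fun n hn => by
    conv_rhs => rw [← hsum n hn]
    rw [ht, Finset.sum_smul]
    exact Finset.sum_congr rfl fun i _ => hf _ _ (hv i) _ hn
  have hunit : IsUnit t := by
    by_contra hu
    obtain ⟨m, hm, htm⟩ := exists_max_ideal_of_mem_nonunits hu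
    have h1 := h ⟨m, hm.isPrime⟩
    have : Subsingleton (LocalizedModule m.primeCompl N) := by
      rw [LocalizedModule.subsingleton_iff]
      intro n
      refine ⟨1 - t, fun h0 => ?_, Subtype.ext ?_⟩
      · exact hm.ne_top ((Ideal.eq_top_iff_one _).2 (by simpa using m.add_mem h0 htm))
      · simp [sub_smul, htn n n.2]
    rw [Module.rankAtStalk, Module.finrank_zero_of_subsingleton] at h1
    exact zero_ne_one h1
  have htt : t * t = t := by
    conv_lhs => rw [ht, Finset.mul_sum]
    rw [ht]
    exact Finset.sum_congr rfl fun i _ => by rw [← smul_eq_mul, ← map_smul, htn _ (hv i)]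
  have ht1 : t = 1 := hunit.mul_left_cancel (by rw [htt, mul_one])
  obtain ⟨k, ⟨e⟩⟩ := Finite.exists_equiv_fin (Module.Free.ChooseBasisIndex R M)
  refine ⟨Fin k, inferInstance, v ∘ e.symm, f ∘ e.symm, fun i => hv _, fun i => hf _, ?_⟩
  rw [← ht1, ht]
  exact Equiv.sum_comp e.symm fun i => f i (v i)

end Lines

/-! ### Base change of subbundles -/

section Intersection

variable {R M : Type*} [CommRing R] [AddCommGroup M] [Module R M]

/-- If `N`, `N'` and `N ⊔ N'` are direct summands, the surjection `N × N' → N ⊔ N'` splits. -/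
lemma exists_sup_splitting [Module.Projective R M]
    {N N' : Submodule R M} {P P' H : M →ₗ[R] M} (hP : LinearMap.IsProj N P)
    (hP' : LinearMap.IsProj N' P') (hH : LinearMap.IsProj (N ⊔ N') H) :
    ∃ s t : M →ₗ[R] M, (∀ m, s m ∈ N) ∧ (∀ m, t m ∈ N') ∧ ∀ m, s m + t m = H m := by
  let φ : M × M →ₗ[R] ↥(N ⊔ N') := (P.coprod P').codRestrict _ fun m =>
    Submodule.add_mem_sup (hP.map_mem _) (hP'.map_mem _)
  have hφ : Function.Surjective φ := by
    rintro ⟨m, hm⟩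
    obtain ⟨a, ha, b, hb, rfl⟩ := Submodule.mem_sup.1 hm
    refine ⟨(a, b), Subtype.ext ?_⟩
    change P a + P' b = a + b
    rw [hP.map_id a ha, hP'.map_id b hb]
  obtain ⟨σ, hσ⟩ := Module.projective_lifting_property φ hH.codRestrict hφ
  refine ⟨P ∘ₗ LinearMap.fst R M M ∘ₗ σ, P' ∘ₗ LinearMap.snd R M M ∘ₗ σ, fun m => hP.map_mem _,
    fun m => hP'.map_mem _, fun m => ?_⟩
  have := congrArg Subtype.val (LinearMap.congr_fun hσ m)
  exact this

/-- The projector onto `N ⊓ N'` given by projectors onto `N` and `N'` and a splitting of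
`N × N' → N ⊔ N'`. Being given by a formula, it is compatible with base change. -/
lemma isProj_inf {N N' : Submodule R M} {P P' s t : M →ₗ[R] M} (hP : LinearMap.IsProj N P)
    (hP' : LinearMap.IsProj N' P') (hs : ∀ m, s m ∈ N) (ht : ∀ m, t m ∈ N')
    (hst : ∀ m ∈ N ⊔ N', s m + t m = m) : LinearMap.IsProj (N ⊓ N') (P - s ∘ₗ (P - P')) := by
  refine ⟨fun m => ⟨N.sub_mem (hP.map_mem m) (hs _), ?_⟩, fun m hm => ?_⟩
  · have h := hst (P m - P' m) (sub_mem (Submodule.mem_sup_left (hP.map_mem m))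
      (Submodule.mem_sup_right (hP'.map_mem m)))
    have : (P - s ∘ₗ (P - P')) m = P' m + t (P m - P' m) := by
      simp only [LinearMap.sub_apply, LinearMap.comp_apply]
      rw [sub_eq_iff_eq_add, add_assoc, add_comm (t _), h, add_sub_cancel]
    rw [this]
    exact N'.add_mem (hP'.map_mem m) (ht _)
  · simp [hP.map_id m hm.1, hP'.map_id m hm.2]

end Intersection

section Pullback

variable {R S : Type*} [CommRing R] [Algebra ℂ R] [CommRing S] [Algebra ℂ S]
  {T T' : Type u} [AddCommGroup T] [Module ℂ T] [AddCommGroup T']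
  [Module ℂ T']

variable (T) in
/-- The base change map `R ⊗ T → S ⊗ T` along `f : R → S`. -/
def baseChangeMap (f : R →ₐ[ℂ] S) : R ⊗[ℂ] T →ₗ[ℂ] S ⊗[ℂ] T :=
  LinearMap.rTensor T f.toLinearMap

@[simp]
lemma baseChangeMap_tmul (f : R →ₐ[ℂ] S) (r : R) (t : T) :
    baseChangeMap T f (r ⊗ₜ t) = f r ⊗ₜ t := rfl

lemma baseChangeMap_smul (f : R →ₐ[ℂ] S) (r : R) (x : R ⊗[ℂ] T) :
    baseChangeMap T f (r • x) = f r • baseChangeMap T f x := by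
  induction x with
  | zero => simp
  | tmul a t => simp [TensorProduct.smul_tmul']
  | add x y hx hy => simp only [smul_add, map_add, hx, hy]

/-- The base change along `f : R → S` of an `R`-linear map between trivial bundles. -/
def extendMap (f : R →ₐ[ℂ] S) (g : R ⊗[ℂ] T →ₗ[R] R ⊗[ℂ] T') : S ⊗[ℂ] T →ₗ[S] S ⊗[ℂ] T' :=
  LinearMap.liftBaseChange S
    (baseChangeMap T' f ∘ₗ g.restrictScalars ℂ ∘ₗ TensorProduct.mk ℂ R T 1)

@[simp]
lemma extendMap_baseChangeMap (f : R →ₐ[ℂ] S) (g : R ⊗[ℂ] T →ₗ[R] R ⊗[ℂ] T') (x : R ⊗[ℂ] T) :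
    extendMap f g (baseChangeMap T f x) = baseChangeMap T' f (g x) := by
  induction x with
  | zero => simp
  | tmul a t =>
    have : a ⊗ₜ[ℂ] t = a • (1 ⊗ₜ t) := by simp [TensorProduct.smul_tmul']
    simp [extendMap, this, map_smul, baseChangeMap_smul]
  | add x y hx hy => simp only [map_add, hx, hy]

/-- The base change along `f : R → S` of a linear form on a trivial bundle. -/
def extendDual (f : R →ₐ[ℂ] S) (g : Module.Dual R (R ⊗[ℂ] T)) : Module.Dual S (S ⊗[ℂ] T) :=
  LinearMap.liftBaseChange S
    (f.toLinearMap ∘ₗ g.restrictScalars ℂ ∘ₗ TensorProduct.mk ℂ R T 1)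

@[simp]
lemma extendDual_baseChangeMap (f : R →ₐ[ℂ] S) (g : Module.Dual R (R ⊗[ℂ] T)) (x : R ⊗[ℂ] T) :
    extendDual f g (baseChangeMap T f x) = f (g x) := by
  induction x with
  | zero => simp
  | tmul a t =>
    have : a ⊗ₜ[ℂ] t = a • (1 ⊗ₜ t) := by simp [TensorProduct.smul_tmul']
    rw [this, baseChangeMap_smul, LinearMap.map_smul, LinearMap.map_smul]
    simp [extendDual]
  | add x y hx hy => simp only [map_add, hx, hy]

lemma baseChangeMap_mem_pullback (f : R →ₐ[ℂ] S) {N : Submodule R (R ⊗[ℂ] T)} {x : R ⊗[ℂ] T}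
    (hx : x ∈ N) : baseChangeMap T f x ∈ pullback f N :=
  Submodule.subset_span ⟨x, hx, rfl⟩

lemma pullback_le {f : R →ₐ[ℂ] S} {N : Submodule R (R ⊗[ℂ] T)} {K : Submodule S (S ⊗[ℂ] T)} :
    pullback f N ≤ K ↔ ∀ x ∈ N, baseChangeMap T f x ∈ K := by
  rw [pullback, Submodule.span_le]
  exact Set.image_subset_iff

lemma pullback_mono (f : R →ₐ[ℂ] S) {N N' : Submodule R (R ⊗[ℂ] T)} (h : N ≤ N') :
    pullback f N ≤ pullback f N' :=
  pullback_le.2 fun _ hx => baseChangeMap_mem_pullback f (h hx)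

lemma pullback_span (f : R →ₐ[ℂ] S) (s : Set (R ⊗[ℂ] T)) :
    pullback f (Submodule.span R s) = Submodule.span S (baseChangeMap T f '' s) := by
  refine le_antisymm (pullback_le.2 fun x hx => ?_) (Submodule.span_le.2 ?_)
  · induction hx using Submodule.span_induction with
    | mem x hx => exact Submodule.subset_span ⟨x, hx, rfl⟩
    | zero => simp
    | add x y _ _ hx hy => rw [map_add]; exact add_mem hx hy
    | smul r x _ hx => rw [baseChangeMap_smul]; exact Submodule.smul_mem _ _ hx
  · rintro _ ⟨x, hx, rfl⟩
    exact baseChangeMap_mem_pullback f (Submodule.subset_span hx)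

lemma pullback_baseChange (f : R →ₐ[ℂ] S) (W : Submodule ℂ T) :
    pullback f (W.baseChange R) = W.baseChange S := by
  rw [Submodule.baseChange_eq_span, Submodule.baseChange_eq_span, pullback_span]
  congr 1
  ext x
  simp

@[simp]
lemma pullback_top (f : R →ₐ[ℂ] S) : pullback f (⊤ : Submodule R (R ⊗[ℂ] T)) = ⊤ := by
  rw [← Submodule.baseChange_top, pullback_baseChange, Submodule.baseChange_top]

lemma pullback_sup (f : R →ₐ[ℂ] S) (N N' : Submodule R (R ⊗[ℂ] T)) :
    pullback f (N ⊔ N') = pullback f N ⊔ pullback f N' := by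
  refine le_antisymm (pullback_le.2 fun x hx => ?_)
    (sup_le (pullback_mono f le_sup_left) (pullback_mono f le_sup_right))
  obtain ⟨a, ha, b, hb, rfl⟩ := Submodule.mem_sup.1 hx
  rw [map_add]
  exact Submodule.add_mem_sup (baseChangeMap_mem_pullback f ha) (baseChangeMap_mem_pullback f hb)

lemma pullback_induction {f : R →ₐ[ℂ] S} {N : Submodule R (R ⊗[ℂ] T)}
    {p : S ⊗[ℂ] T → Prop} (mem : ∀ x ∈ N, p (baseChangeMap T f x)) (zero : p 0)
    (add : ∀ x y, p x → p y → p (x + y)) (smul : ∀ (s : S) x, p x → p (s • x))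
    {y : S ⊗[ℂ] T} (hy : y ∈ pullback f N) : p y := by
  induction hy using Submodule.span_induction with
  | mem y hy => obtain ⟨x, hx, rfl⟩ := hy; exact mem x hx
  | zero => exact zero
  | add x y _ _ hx hy => exact add x y hx hy
  | smul s x _ hx => exact smul s x hx

/-- Two `S`-linear maps on `S ⊗ T` that agree on the image of `R ⊗ T` are equal. -/
lemma linearMap_ext_baseChangeMap {f : R →ₐ[ℂ] S} {M : Type*} [AddCommGroup M] [Module S M]
    {g g' : S ⊗[ℂ] T →ₗ[S] M} (h : ∀ x, g (baseChangeMap T f x) = g' (baseChangeMap T f x)) :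
    g = g' := by
  refine LinearMap.ext fun y => pullback_induction (f := f) (N := ⊤) (p := fun y => g y = g' y)
    (fun x _ => h x) (by simp) (fun x y hx hy => ?_) (fun s x hx => ?_) (by simp)
  · rw [map_add, map_add, hx, hy]
  · rw [map_smul, map_smul, hx]

lemma extendMap_mem_pullback (f : R →ₐ[ℂ] S) {g : R ⊗[ℂ] T →ₗ[R] R ⊗[ℂ] T'}
    {K : Submodule R (R ⊗[ℂ] T')} (hg : ∀ x, g x ∈ K) (y : S ⊗[ℂ] T) :
    extendMap f g y ∈ pullback f K := by
  refine pullback_induction (f := f) (N := ⊤) (p := fun y => extendMap f g y ∈ pullback f K)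
    (fun x _ => ?_) (by simp) (fun x y hx hy => ?_) (fun s x hx => ?_) (by simp)
  · rw [extendMap_baseChangeMap]
    exact baseChangeMap_mem_pullback f (hg x)
  · rw [map_add]; exact add_mem hx hy
  · rw [map_smul]; exact Submodule.smul_mem _ _ hx

lemma isProj_pullback (f : R →ₐ[ℂ] S) {N : Submodule R (R ⊗[ℂ] T)}
    {P : R ⊗[ℂ] T →ₗ[R] R ⊗[ℂ] T} (hP : LinearMap.IsProj N P) :
    LinearMap.IsProj (pullback f N) (extendMap f P) := by
  refine ⟨extendMap_mem_pullback f hP.map_mem, fun y hy => ?_⟩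
  · refine pullback_induction (p := fun y => extendMap f P y = y) (fun x hx => ?_)
      (by simp) (fun x y hx hy => ?_) (fun s x hx => ?_) hy
    · rw [extendMap_baseChangeMap, hP.map_id x hx]
    · rw [map_add, hx, hy]
    · rw [map_smul, hx]

lemma IsLine.pullback (f : R →ₐ[ℂ] S) {N : Submodule R (R ⊗[ℂ] T)} (hN : IsLine N) :
    IsLine (pullback f N) := by
  obtain ⟨ι, _, v, g, hv, hg, h1⟩ := hN
  refine ⟨ι, inferInstance, fun i => baseChangeMap T f (v i), fun i => extendDual f (g i),
    fun i => baseChangeMap_mem_pullback f (hv i), fun i n hn n' hn' => ?_, ?_⟩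
  · refine pullback_induction (f := f) (N := N)
      (p := fun n => extendDual f (g i) n • n' = extendDual f (g i) n' • n) (fun x hx => ?_)
      (by simp) (fun x y hx hy => ?_) (fun s x hx => ?_) hn
    · refine pullback_induction (f := f) (N := N)
        (p := fun n' => extendDual f (g i) (baseChangeMap T f x) • n' =
          extendDual f (g i) n' • baseChangeMap T f x) (fun y hy => ?_)
        (by simp) (fun y z hx hy => ?_) (fun s y hx => ?_) hn'
      · rw [extendDual_baseChangeMap, extendDual_baseChangeMap, ← baseChangeMap_smul,
          ← baseChangeMap_smul, hg i x hx y hy]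
      · rw [smul_add, hx, hy, map_add, add_smul]
      · rw [smul_comm, hx, map_smul, smul_assoc]
    · rw [map_add, add_smul, hx, hy, smul_add]
    · rw [map_smul, smul_assoc, hx, smul_comm]
  · simp [← map_sum, h1]

/-- Base change commutes with the intersection of two subbundles whose sum is a subbundle. -/
lemma pullback_inf (f : R →ₐ[ℂ] S) [Module.Projective R (R ⊗[ℂ] T)]
    {N N' : Submodule R (R ⊗[ℂ] T)} {P P' H : R ⊗[ℂ] T →ₗ[R] R ⊗[ℂ] T}
    (hP : LinearMap.IsProj N P) (hP' : LinearMap.IsProj N' P')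
    (hH : LinearMap.IsProj (N ⊔ N') H) :
    pullback f (N ⊓ N') = pullback f N ⊓ pullback f N' := by
  obtain ⟨s, t, hs, ht, hst⟩ := exists_sup_splitting hP hP' hH
  have h1 := isProj_inf hP hP' hs ht fun m hm => by rw [hst, hH.map_id m hm]
  have h2 := isProj_inf (isProj_pullback f hP) (isProj_pullback f hP') (extendMap_mem_pullback f hs)
    (extendMap_mem_pullback f ht) (fun m hm => by
      rw [← pullback_sup] at hm
      refine pullback_induction (p := fun y => extendMap f s y + extendMap f t y = y)
        (fun x hx => ?_) (by simp) (fun x y hx hy => ?_) (fun s x hx => ?_) hm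
      · rw [extendMap_baseChangeMap, extendMap_baseChangeMap, ← map_add, hst, hH.map_id x hx]
      · rw [map_add, map_add, add_add_add_comm, hx, hy]
      · rw [map_smul, map_smul, ← smul_add, hx])
  refine le_antisymm (le_inf (pullback_mono f inf_le_left) (pullback_mono f inf_le_right))
    fun y hy => ?_
  have h3 := isProj_pullback f h1
  have h4 : extendMap f (P - s ∘ₗ (P - P')) =
      extendMap f P - extendMap f s ∘ₗ (extendMap f P - extendMap f P') :=
    linearMap_ext_baseChangeMap (f := f) fun x => by simp
  rw [← h2.map_id y hy, ← h4]
  exact h3.map_mem y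

/-- For a direct summand `N` of `R ⊗ T`, the map `S ⊗ N → S ⊗ T` is injective with image
`pullback f N`, so that `pullback f N` has the rank of `N`. -/
lemma rankAtStalk_pullback (f : R →ₐ[ℂ] S) {N : Submodule R (R ⊗[ℂ] T)}
    {P : R ⊗[ℂ] T →ₗ[R] R ⊗[ℂ] T} (hP : LinearMap.IsProj N P) [Module.Finite R (R ⊗[ℂ] T)]
    [Module.Projective R (R ⊗[ℂ] T)] (p : PrimeSpectrum S) :
    Module.rankAtStalk (R := S) (pullback f N) p =
      Module.rankAtStalk (R := R) N (p.comap f.toRingHom) := by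
  have hfin := finite_of_isProj hP
  have hproj := projective_of_isProj hP
  let := f.toRingHom.toAlgebra
  have : IsScalarTower ℂ R S := IsScalarTower.of_algebraMap_eq fun c => (f.commutes c).symm
  let e := TensorProduct.AlgebraTensorModule.cancelBaseChange ℂ R S S T
  let ψ : S ⊗[R] N →ₗ[S] S ⊗[ℂ] T := e.toLinearMap ∘ₗ N.subtype.baseChange S
  have hψ : ∀ (s : S) (n : N), ψ (s ⊗ₜ n) = s • baseChangeMap T f n := by
    intro s n
    have : ∀ x : R ⊗[ℂ] T, e (s ⊗ₜ x) = s • baseChangeMap T f x := fun x => by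
      induction x with
      | zero => simp
      | tmul a t =>
        simp [e, TensorProduct.smul_tmul', Algebra.smul_def, RingHom.algebraMap_toAlgebra, mul_comm]
      | add x y hx hy => rw [TensorProduct.tmul_add, map_add, hx, hy, map_add, smul_add]
    exact this n
  have hinj : Function.Injective ψ := by
    refine e.injective.comp ?_
    refine Function.LeftInverse.injective (g := hP.codRestrict.baseChange S) fun x => ?_
    rw [← LinearMap.comp_apply, ← LinearMap.baseChange_comp]
    have : hP.codRestrict ∘ₗ N.subtype = LinearMap.id :=
      LinearMap.ext fun x => hP.codRestrict_apply_cod x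
    rw [this, LinearMap.baseChange_id, LinearMap.id_apply]
  have hrange : LinearMap.range ψ = pullback f N := by
    refine le_antisymm ?_ (pullback_le.2 fun x hx => ⟨1 ⊗ₜ ⟨x, hx⟩, by rw [hψ, one_smul]⟩)
    rintro _ ⟨x, rfl⟩
    induction x with
    | zero => simp
    | tmul s n => rw [hψ]; exact Submodule.smul_mem _ _ (baseChangeMap_mem_pullback f n.2)
    | add x y hx hy => rw [map_add]; exact add_mem hx hy
  rw [← hrange, ← Module.rankAtStalk_eq_of_equiv (LinearEquiv.ofInjective ψ hinj)]
  exact Module.rankAtStalk_baseChange (R := R) (M := N) p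

end Pullback

/-! ### Subbundles, projectors and closed points -/

section Subbundle

variable {R M : Type*} [CommRing R] [AddCommGroup M] [Module R M]

lemma exists_isProj_of_projective_quotient (N : Submodule R M) [Module.Projective R (M ⧸ N)] :
    ∃ P : M →ₗ[R] M, LinearMap.IsProj N P := by
  obtain ⟨s, hs⟩ := Module.projective_lifting_property N.mkQ LinearMap.id N.mkQ_surjective
  refine ⟨LinearMap.id - s ∘ₗ N.mkQ, fun m => ?_, fun m hm => ?_⟩
  · refine (Submodule.Quotient.mk_eq_zero N).1 ?_
    change N.mkQ _ = 0
    have := LinearMap.congr_fun hs (N.mkQ m)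
    simp only [LinearMap.comp_apply, LinearMap.id_apply] at this
    simp only [LinearMap.sub_apply, LinearMap.id_apply, LinearMap.comp_apply, map_sub, this,
      sub_self]
  · have : N.mkQ m = 0 := by simpa using hm
    simp only [LinearMap.sub_apply, LinearMap.id_apply, LinearMap.comp_apply, this, map_zero,
      sub_zero]

lemma projective_quotient_of_isProj [Module.Projective R M] {N : Submodule R M} {P : M →ₗ[R] M}
    (hP : LinearMap.IsProj N P) : Module.Projective R (M ⧸ N) := by
  refine Module.Projective.of_split (N.liftQ (LinearMap.id - P) fun n hn => ?_) N.mkQ ?_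
  · simp [hP.map_id n hn]
  · refine Submodule.linearMap_qext _ (LinearMap.ext fun m => ?_)
    simpa using hP.map_mem m

lemma IsSubbundle.exists_isProj {r : ℕ} {N : Submodule R M} (h : IsSubbundle r N) :
    ∃ P : M →ₗ[R] M, LinearMap.IsProj N P :=
  have := h.2.1
  exists_isProj_of_projective_quotient N

lemma isSubbundle_of_isProj [Module.Projective R M] [Module.Finite R M] {r : ℕ}
    {N : Submodule R M} {P : M →ₗ[R] M} (hP : LinearMap.IsProj N P)
    (h : ∀ p : PrimeSpectrum R, Module.rankAtStalk (R := R) N p = r) : IsSubbundle r N :=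
  ⟨inferInstance, projective_quotient_of_isProj hP, h⟩

lemma IsSubbundle.isLine [Module.Free R M] [Module.Finite R M] {N : Submodule R M}
    (h : IsSubbundle 1 N) : IsLine N :=
  have ⟨_, hP⟩ := h.exists_isProj
  isLine_of_isProj hP h.2.2

end Subbundle

section Field

variable {K M : Type*} [Field K] [AddCommGroup M] [Module K M]

lemma exists_isProj_of_field (N : Submodule K M) : ∃ P : M →ₗ[K] M, LinearMap.IsProj N P :=
  exists_isProj_of_projective_quotient N

lemma isSubbundle_iff_finrank [Module.Finite K M] {r : ℕ} {N : Submodule K M} :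
    IsSubbundle r N ↔ Module.finrank K N = r := by
  simp only [IsSubbundle, Module.rankAtStalk_eq_finrank_of_free]
  exact ⟨fun h => by simpa using h.2.2 ⊥, fun h => ⟨inferInstance, inferInstance, fun p => by
    simpa using h⟩⟩

lemma IsLine.finrank_eq_one {N : Submodule K M} (h : IsLine N) : Module.finrank K N = 1 := by
  have h' := h
  obtain ⟨ι, _, v, f, hv, hf, h1⟩ := h
  obtain ⟨i, hi⟩ : ∃ i, f i (v i) ≠ 0 := by
    by_contra! h0
    simp [h0] at h1
  rw [finrank_eq_one_iff_of_nonzero' (⟨v i, hv i⟩ : N)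
    (fun h0 => hi (by rw [show v i = 0 from congrArg Subtype.val h0, map_zero]))]
  rintro ⟨w, hw⟩
  refine ⟨(f i (v i))⁻¹ * f i w, Subtype.ext ?_⟩
  simp [mul_smul, hf i w hw (v i) (hv i), smul_smul, inv_mul_cancel₀ hi]

end Field

section ClosedPoints

variable {R : Type*} [CommRing R] [Algebra ℂ R] {T : Type u} [AddCommGroup T] [Module ℂ T]

/-- The Nullstellensatz: closed points of a `ℂ`-algebra of finite type are `ℂ`-points. -/
lemma exists_algHom_ker_eq [Algebra.FiniteType ℂ R] (m : Ideal R) [hm : m.IsMaximal] :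
    ∃ x : R →ₐ[ℂ] ℂ, RingHom.ker x = m := by
  let := Ideal.Quotient.field m
  have : Module.Finite ℂ (R ⧸ m) := finite_of_finite_type_of_isJacobsonRing ℂ (R ⧸ m)
  have hb : Function.Bijective (algebraMap ℂ (R ⧸ m)) :=
    IsAlgClosed.algebraMap_bijective_of_isIntegral
  let e : ℂ ≃ₐ[ℂ] R ⧸ m := AlgEquiv.ofBijective (Algebra.ofId ℂ (R ⧸ m)) hb
  refine ⟨(e.symm : R ⧸ m →ₐ[ℂ] ℂ).comp (Ideal.Quotient.mkₐ ℂ m), ?_⟩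
  ext r
  simp [RingHom.mem_ker, Ideal.Quotient.eq_zero_iff_mem]

variable [Module.Finite ℂ T]

lemma IsSubbundle.pullback {S : Type*} [CommRing S] [Algebra ℂ S] (f : R →ₐ[ℂ] S) {r : ℕ}
    {N : Submodule R (R ⊗[ℂ] T)} (h : IsSubbundle r N) : IsSubbundle r (pullback f N) := by
  obtain ⟨P, hP⟩ := h.exists_isProj
  exact isSubbundle_of_isProj (isProj_pullback f hP) fun p => by
    rw [rankAtStalk_pullback f hP, h.2.2]

variable [Algebra.FiniteType ℂ R]

/-- The rank of a direct summand may be computed at the closed points. -/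
lemma isSubbundle_of_finrank_pullback {r : ℕ} {N : Submodule R (R ⊗[ℂ] T)}
    {P : R ⊗[ℂ] T →ₗ[R] R ⊗[ℂ] T} (hP : LinearMap.IsProj N P)
    (h : ∀ x : R →ₐ[ℂ] ℂ, Module.finrank ℂ (pullback x N) = r) : IsSubbundle r N := by
  refine isSubbundle_of_isProj hP fun p => ?_
  have hfin := finite_of_isProj hP
  have hproj := projective_of_isProj hP
  obtain ⟨m, hm, hpm⟩ := p.asIdeal.exists_le_maximal p.isPrime.ne_top
  obtain ⟨x, hx⟩ := exists_algHom_ker_eq m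
  have h1 : (⟨m, hm.isPrime⟩ : PrimeSpectrum R) =
      (⊥ : PrimeSpectrum ℂ).comap x.toRingHom := by
    ext r
    change r ∈ m ↔ x r = 0
    rw [← hx, RingHom.mem_ker]
  rw [Module.rankAtStalk_eq_of_le_of_finite_of_flat N (q := ⟨m, hm.isPrime⟩) hpm, h1,
    ← rankAtStalk_pullback x hP, Module.rankAtStalk_eq_finrank_of_free]
  simpa using h x

lemma IsLine.isSubbundle {N : Submodule R (R ⊗[ℂ] T)} (h : IsLine N) : IsSubbundle 1 N :=
  have ⟨_, hP⟩ := h.exists_isProj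
  isSubbundle_of_finrank_pullback hP fun x => (h.pullback x).finrank_eq_one

/-- Nakayama's lemma: an inclusion into a direct summand that is surjective at all closed points
is an equality. -/
lemma le_of_pullback_le {N H : Submodule R (R ⊗[ℂ] T)} {P : R ⊗[ℂ] T →ₗ[R] R ⊗[ℂ] T}
    (hP : LinearMap.IsProj H P) (hNH : N ≤ H)
    (h : ∀ x : R →ₐ[ℂ] ℂ, pullback x H ≤ pullback x N) : H ≤ N := by
  have hfg : (H.map N.mkQ).FG := by
    have : H.FG := by rw [← hP.range, LinearMap.range_eq_map]; exact Module.Finite.fg_top.map P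
    exact this.map _
  suffices h0 : Module.annihilator R (H.map N.mkQ) = ⊤ by
    intro y hy
    have h1 : (1 : R) ∈ Module.annihilator R (H.map N.mkQ) := by simp [h0]
    have := Module.mem_annihilator.1 h1 ⟨N.mkQ y, Submodule.mem_map_of_mem hy⟩
    simpa using congrArg Subtype.val this
  by_contra h0
  obtain ⟨m, hm, hle⟩ := Ideal.exists_le_maximal _ h0
  obtain ⟨x, hx⟩ := exists_algHom_ker_eq m
  -- An element of `R ⊗ T` differs from its value at `x` by an element of `m (R ⊗ T)`.
  have hsub : ∀ z : R ⊗[ℂ] T, z - LinearMap.rTensor T (Algebra.linearMap ℂ R)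
      (baseChangeMap T x z) ∈ m • (⊤ : Submodule R (R ⊗[ℂ] T)) := by
    intro z
    induction z with
    | zero => simp
    | tmul r t =>
      have : (r - algebraMap ℂ R (x r)) ⊗ₜ[ℂ] t = (r - algebraMap ℂ R (x r)) • (1 ⊗ₜ t) := by
        simp [TensorProduct.smul_tmul']
      simp only [baseChangeMap_tmul, LinearMap.rTensor_tmul, Algebra.linearMap_apply,
        ← TensorProduct.sub_tmul]
      rw [this]
      refine Submodule.smul_mem_smul ?_ trivial
      rw [← hx, RingHom.mem_ker]
      simp
    | add a b ha hb =>
      rw [map_add, map_add, add_sub_add_comm]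
      exact add_mem ha hb
  have hker : ∀ z : R ⊗[ℂ] T, baseChangeMap T x z = 0 → z ∈ m • (⊤ : Submodule R (R ⊗[ℂ] T)) :=
    fun z hz => by simpa [hz] using hsub z
  have hsurj : Function.Surjective x := fun c => ⟨algebraMap ℂ R c, by simp⟩
  -- Since `x` is surjective, the span in the definition of `pullback` is not needed.
  have hpull : ∀ y ∈ pullback x N, ∃ n ∈ N, baseChangeMap T x n = y := by
    intro y hy
    refine pullback_induction (p := fun y => ∃ n ∈ N, baseChangeMap T x n = y)
      (fun n hn => ⟨n, hn, rfl⟩) ⟨0, N.zero_mem, by simp⟩ ?_ ?_ hy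
    · rintro _ _ ⟨a, ha, rfl⟩ ⟨b, hb, rfl⟩
      exact ⟨a + b, N.add_mem ha hb, map_add _ _ _⟩
    · rintro s _ ⟨a, ha, rfl⟩
      obtain ⟨r, rfl⟩ := hsurj s
      exact ⟨r • a, N.smul_mem r ha, baseChangeMap_smul _ _ _⟩
  have hmH : H.map N.mkQ ≤ m • H.map N.mkQ := by
    rintro _ ⟨y, hy, rfl⟩
    obtain ⟨n, hn, hn'⟩ := hpull _ (h x (baseChangeMap_mem_pullback x hy))
    have h1 : y - n ∈ m • (⊤ : Submodule R (R ⊗[ℂ] T)) := hker _ (by rw [map_sub, hn', sub_self])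
    have h2 : y - n ∈ m • H := by
      have h3 : P (y - n) ∈ (m • (⊤ : Submodule R (R ⊗[ℂ] T))).map P := ⟨_, h1, rfl⟩
      rwa [hP.map_id _ (H.sub_mem hy (hNH hn)), Submodule.map_smul'', Submodule.map_top,
        hP.range] at h3
    rw [← Submodule.map_smul'']
    refine ⟨y - n, h2, ?_⟩
    simpa using hn
  obtain ⟨r, hr, hr'⟩ := Submodule.exists_sub_one_mem_and_smul_eq_zero_of_fg_of_le_smul m _ hfg hmH
  have hrm : r ∈ m := hle (Module.mem_annihilator.2 fun c => Subtype.ext (hr' c c.2))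
  exact hm.ne_top ((Ideal.eq_top_iff_one _).2 (by simpa using m.sub_mem hrm hr))

end ClosedPoints

/-! ### The wedge product of lines -/

section WedgeLines

variable {R M M₂ : Type*} [CommRing R] [AddCommGroup M] [Module R M] [AddCommGroup M₂] [Module R M₂]
  {β : M →ₗ[R] M →ₗ[R] M₂} {c : Module.Dual R M → M₂ →ₗ[R] M}
  {ι : Type} {L U N : Submodule R M}
  {v : ι → M} {f : ι → Module.Dual R M}

/-- The wedge square of a line vanishes. -/
lemma IsLine.wedge_eq_zero (h2 : IsUnit (2 : R)) (hβ : β.IsAlt) (hL : IsLine L) {l l' : M}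
    (hl : l ∈ L) (hl' : l' ∈ L) : β l l' = 0 := by
  obtain ⟨ι, _, v, f, hv, hf, h1⟩ := hL
  have h : β l l' = β l' l := by
    conv_lhs => rw [← sum_smul_eq_self_of_frame hv hf h1 hl]
    conv_rhs => rw [← sum_smul_eq_self_of_frame hv hf h1 hl']
    simp only [map_sum, map_smul, LinearMap.sum_apply, LinearMap.smul_apply]
    refine Finset.sum_congr rfl fun i _ => ?_
    rw [← map_smul, ← map_smul, hf i l hl l' hl']
  refine h2.smul_eq_zero.1 ?_
  rw [two_smul]
  nth_rw 1 [h]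
  rw [← hβ.neg l l', neg_add_cancel]

-- `β` plays the role of the wedge product, `c g` of the contraction with the linear form `g`, and
-- `(v, f)` is a frame of the line `L`.
variable (hβ : β.IsAlt) (hc : ∀ g a b, c g (β a b) = g a • b - g b • a)
  (hv : ∀ i, v i ∈ L) (hf : ∀ i, ∀ n ∈ L, ∀ n' ∈ L, f i n • n' = f i n' • n)

include hβ hc hv hf in
/-- The contractions with a frame of a line `L` give a projector onto `L ∧ M`. -/
lemma isProj_wedge_top [Fintype ι] (h1 : ∑ i, f i (v i) = 1)
    (h2 : IsUnit (2 : R)) :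
    LinearMap.IsProj (Submodule.map₂ β L ⊤) (∑ i, β (v i) ∘ₗ c (f i)) := by
  refine ⟨fun m => ?_, fun m hm => ?_⟩
  · rw [LinearMap.sum_apply]
    exact Submodule.sum_mem _ fun i _ => Submodule.apply_mem_map₂ β (hv i) trivial
  · have hle : Submodule.map₂ β L ⊤ ≤
        LinearMap.eqLocus (∑ i, β (v i) ∘ₗ c (f i)) LinearMap.id := by
      refine Submodule.map₂_le.2 fun l hl a _ => ?_
      have hz : ∀ i, β (v i) l = 0 := fun i =>
        IsLine.wedge_eq_zero h2 hβ ⟨ι, inferInstance, v, f, hv, hf, h1⟩ (hv i) hl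
      rw [LinearMap.mem_eqLocus, LinearMap.id_apply]
      conv_rhs => rw [← sum_smul_eq_self_of_frame hv hf h1 hl]
      simp [hc, hz]
    exact hle hm

variable {p : M →ₗ[R] M}

/-- The component along the complement `Ker p` of a line of the contraction with `g`. -/
def contractCompl (c : Module.Dual R M → M₂ →ₗ[R] M) (p : M →ₗ[R] M) (g : Module.Dual R M) :
    M₂ →ₗ[R] M :=
  (LinearMap.id - p) ∘ₗ c g

include hc in
lemma contractCompl_wedge (hp : LinearMap.IsProj L p) (g : Module.Dual R M) {l : M} (hl : l ∈ L)
    (a : M) : contractCompl c p g (β l a) = g l • (a - p a) := by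
  simp [contractCompl, hc, hp.map_id l hl, smul_sub]

include hβ hc hf in
lemma wedge_contractCompl (h2 : IsUnit (2 : R)) (hL : IsLine L) (hp : LinearMap.IsProj L p) (i : ι)
    {l : M} (hl : l ∈ L) {m : M₂} (hm : m ∈ Submodule.map₂ β L ⊤) :
    β l (contractCompl c p (f i) m) = f i l • m := by
  have hle : Submodule.map₂ β L ⊤ ≤
      LinearMap.eqLocus (β l ∘ₗ contractCompl c p (f i)) (f i l • LinearMap.id) := by
    refine Submodule.map₂_le.2 fun l' hl' a _ => ?_
    rw [LinearMap.mem_eqLocus, LinearMap.comp_apply, contractCompl_wedge hc hp _ hl', map_smul,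
      map_sub, hL.wedge_eq_zero h2 hβ hl (hp.map_mem a), sub_zero, LinearMap.smul_apply,
      LinearMap.id_apply, ← LinearMap.map_smul₂, hf i l' hl' l hl, LinearMap.map_smul₂]
  exact hle hm

include hc hf in
lemma contractCompl_smul_comm (hp : LinearMap.IsProj L p) (h : Module.Dual R M) (i k : ι)
    {m m' : M₂} (hm : m ∈ Submodule.map₂ β L ⊤) (hm' : m' ∈ Submodule.map₂ β L ⊤) :
    h (contractCompl c p (f i) m) • contractCompl c p (f k) m' =
      h (contractCompl c p (f k) m) • contractCompl c p (f i) m' := by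
  have hle : Submodule.map₂ β L ⊤ ≤
      LinearMap.eqLocus ((h ∘ₗ contractCompl c p (f i)).smulRight (contractCompl c p (f k) m'))
        ((h ∘ₗ contractCompl c p (f k)).smulRight (contractCompl c p (f i) m')) := by
    refine Submodule.map₂_le.2 fun l hl a _ => ?_
    have hle' : Submodule.map₂ β L ⊤ ≤ LinearMap.eqLocus
        (h (contractCompl c p (f i) (β l a)) • contractCompl c p (f k))
        (h (contractCompl c p (f k) (β l a)) • contractCompl c p (f i)) := by
      refine Submodule.map₂_le.2 fun l' hl' a' _ => ?_
      have hs : f i l * f k l' = f k l * f i l' := by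
        simpa [mul_comm] using congrArg (f k) (hf i l hl l' hl')
      simp only [LinearMap.mem_eqLocus, LinearMap.smul_apply, contractCompl_wedge hc hp _ hl,
        contractCompl_wedge hc hp _ hl', map_smul, smul_smul, smul_eq_mul]
      congr 1
      linear_combination h (a - p a) * hs
    exact hle' hm'
  exact hle hm

/-- For `N ⊆ L ∧ M`, the submodule `U` of the complement `Ker p` of `L` with `L ∧ U = N`, spanned by
the contractions of `N` with the linear forms of a frame of `L`. -/
def residual (c : Module.Dual R M → M₂ →ₗ[R] M) (p : M →ₗ[R] M) (f : ι → Module.Dual R M)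
    (N : Submodule R M₂) : Submodule R M :=
  ⨆ i, N.map (contractCompl c p (f i))

variable {N : Submodule R M₂}

lemma apply_eq_zero_of_mem_residual (hp : LinearMap.IsProj L p) {u : M}
    (hu : u ∈ residual c p f N) : p u = 0 := by
  have hle : residual c p f N ≤ LinearMap.ker p := by
    refine iSup_le fun i => ?_
    rintro _ ⟨m, -, rfl⟩
    simp [contractCompl, hp.map_id _ (hp.map_mem _)]
  exact hle hu

include hβ hc hv hf in
lemma wedge_residual [Fintype ι] (h1 : ∑ i, f i (v i) = 1)
    (h2 : IsUnit (2 : R)) (hp : LinearMap.IsProj L p)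
    (hN : N ≤ Submodule.map₂ β L ⊤) : Submodule.map₂ β L (residual c p f N) = N := by
  have hL : IsLine L := ⟨ι, inferInstance, v, f, hv, hf, h1⟩
  refine le_antisymm (Submodule.map₂_le.2 fun l hl u hu => ?_) fun m hm => ?_
  · have hle : residual c p f N ≤ N.comap (β l) := by
      refine iSup_le fun i => ?_
      rintro _ ⟨m, hm, rfl⟩
      rw [Submodule.mem_comap, wedge_contractCompl hβ hc hf h2 hL hp i hl (hN hm)]
      exact N.smul_mem _ hm
    exact hle hu
  · have : ∑ i, β (v i) (contractCompl c p (f i) m) = m := by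
      simp_rw [fun i => wedge_contractCompl hβ hc hf h2 hL hp i (hv i) (hN hm), ← Finset.sum_smul,
        h1, one_smul]
    rw [← this]
    exact Submodule.sum_mem _ fun i _ => Submodule.apply_mem_map₂ β (hv i)
      (Submodule.mem_iSup_of_mem i (Submodule.mem_map_of_mem hm))

include hβ hc hv hf in
lemma isLine_residual [Fintype ι] (h1 : ∑ i, f i (v i) = 1)
    (h2 : IsUnit (2 : R)) (hp : LinearMap.IsProj L p)
    (hN : N ≤ Submodule.map₂ β L ⊤) (hNl : IsLine N) : IsLine (residual c p f N) := by
  have hL : IsLine L := ⟨ι, inferInstance, v, f, hv, hf, h1⟩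
  have hNl' := hNl
  obtain ⟨κ, _, w, g, hw, hg, hg1⟩ := hNl'
  refine ⟨ι × κ, inferInstance, fun x => contractCompl c p (f x.1) (w x.2),
    fun x => g x.2 ∘ₗ β (v x.1), fun x => Submodule.mem_iSup_of_mem x.1
      (Submodule.mem_map_of_mem (hw x.2)), ?_, ?_⟩
  · suffices H : ∀ (h : Module.Dual R M), ∀ n ∈ residual c p f N, ∀ n' ∈ residual c p f N,
        h n • n' = h n' • n from fun x => H _
    intro h n hn n' hn'
    have hle : residual c p f N ≤ LinearMap.eqLocus (h.smulRight n') (h n' • LinearMap.id) := by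
      refine iSup_le fun i => ?_
      rintro _ ⟨m, hm, rfl⟩
      have hle' : residual c p f N ≤ LinearMap.eqLocus (h (contractCompl c p (f i) m) •
          LinearMap.id) (h.smulRight (contractCompl c p (f i) m)) := by
        refine iSup_le fun k => ?_
        rintro _ ⟨m', hm', rfl⟩
        simp only [LinearMap.mem_eqLocus, LinearMap.smul_apply, LinearMap.id_apply,
          LinearMap.smulRight_apply]
        have hx := congrArg (contractCompl c p (f i))
          (hNl.apply_smul_comm (h ∘ₗ contractCompl c p (f k)) hm hm')
        rw [map_smul, map_smul] at hx
        rw [contractCompl_smul_comm hc hf hp h i k (hN hm) (hN hm')]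
        exact hx
      exact hle' hn'
    exact hle hn
  · rw [Fintype.sum_prod_type_right, ← hg1]
    refine Finset.sum_congr rfl fun j _ => ?_
    simp_rw [LinearMap.comp_apply,
      fun i => wedge_contractCompl hβ hc hf h2 hL hp i (hv i) (hN (hw j)), ← map_sum,
      ← Finset.sum_smul, h1, one_smul]

include hc hv in
lemma residual_wedge [Fintype ι] (h1 : ∑ i, f i (v i) = 1)
    (hp : LinearMap.IsProj L p) (hpU : ∀ u ∈ U, p u = 0) :
    residual c p f (Submodule.map₂ β L U) = U := by
  refine le_antisymm (iSup_le fun i => Submodule.map_le_iff_le_comap.2 <|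
    Submodule.map₂_le.2 fun l hl u hu => ?_) fun u hu => ?_
  · rw [Submodule.mem_comap, contractCompl_wedge hc hp _ hl, hpU u hu, sub_zero]
    exact U.smul_mem _ hu
  · have : u = ∑ i, contractCompl c p (f i) (β (v i) u) := by
      simp_rw [fun i => contractCompl_wedge hc hp (f i) (hv i) u, hpU u hu, sub_zero,
        ← Finset.sum_smul, h1, one_smul]
    rw [this]
    exact Submodule.sum_mem _ fun i _ => Submodule.mem_iSup_of_mem i
      (Submodule.mem_map_of_mem (Submodule.apply_mem_map₂ β (hv i) hu))

include hc in
lemma IsLine.wedge (hp : LinearMap.IsProj L p) (hpU : ∀ u ∈ U, p u = 0) (hL : IsLine L)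
    (hU : IsLine U) : IsLine (Submodule.map₂ β L U) := by
  obtain ⟨ι, _, v, f, hv, hf, h1⟩ := hL
  obtain ⟨κ, _, w, g, hw, hg, hg1⟩ := hU
  have happ : ∀ (i : ι) (j : κ), ∀ l ∈ L, ∀ u ∈ U, (g j ∘ₗ contractCompl c p (f i)) (β l u) =
      f i l * g j u := fun i j l hl u hu => by
    rw [LinearMap.comp_apply, contractCompl_wedge hc hp _ hl, hpU u hu, sub_zero, map_smul,
      smul_eq_mul]
  refine ⟨ι × κ, inferInstance, fun x => β (v x.1) (w x.2),
    fun x => g x.2 ∘ₗ contractCompl c p (f x.1),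
    fun x => Submodule.apply_mem_map₂ β (hv _) (hw _), fun ⟨i, j⟩ n hn n' hn' => ?_, ?_⟩
  · have hle : Submodule.map₂ β L U ≤ LinearMap.eqLocus
        ((g j ∘ₗ contractCompl c p (f i)).smulRight n')
        ((g j ∘ₗ contractCompl c p (f i)) n' • LinearMap.id) := by
      refine Submodule.map₂_le.2 fun l hl u hu => ?_
      have hle' : Submodule.map₂ β L U ≤ LinearMap.eqLocus
          ((g j ∘ₗ contractCompl c p (f i)) (β l u) • LinearMap.id)
          ((g j ∘ₗ contractCompl c p (f i)).smulRight (β l u)) := by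
        refine Submodule.map₂_le.2 fun l' hl' u' hu' => ?_
        rw [LinearMap.mem_eqLocus, LinearMap.smulRight_apply, LinearMap.smul_apply,
          LinearMap.id_apply, happ i j l hl u hu, happ i j l' hl' u' hu', mul_smul, mul_smul,
          ← map_smul, ← LinearMap.map_smul₂, hf i l hl l' hl', hg j u hu u' hu',
          LinearMap.map_smul₂, map_smul]
      exact hle' hn'
    exact hle hn
  · rw [Fintype.sum_prod_type]
    simp_rw [fun i j => happ i j (v i) (hv i) (w j) (hw j), ← Finset.mul_sum, hg1, mul_one, h1]

include hβ in
lemma wedge_sup_self (h2 : IsUnit (2 : R)) (hL : IsLine L) (hU : IsLine U) :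
    Submodule.map₂ β (L ⊔ U) (L ⊔ U) = Submodule.map₂ β L U := by
  refine le_antisymm (Submodule.map₂_le.2 fun a ha b hb => ?_)
    (Submodule.map₂_le_map₂ le_sup_left le_sup_right)
  obtain ⟨l, hl, u, hu, rfl⟩ := Submodule.mem_sup.1 ha
  obtain ⟨l', hl', u', hu', rfl⟩ := Submodule.mem_sup.1 hb
  have : β (l + u) (l' + u') = β l u' - β l' u := by
    rw [map_add, LinearMap.map_add₂, LinearMap.map_add₂, hL.wedge_eq_zero h2 hβ hl hl',
      hU.wedge_eq_zero h2 hβ hu hu', ← hβ.neg l' u]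
    abel
  rw [this]
  exact sub_mem (Submodule.apply_mem_map₂ β hl hu') (Submodule.apply_mem_map₂ β hl' hu)

lemma isProj_sup (hp : LinearMap.IsProj L p) (hpU : ∀ u ∈ U, p u = 0) {P : M →ₗ[R] M}
    (hP : LinearMap.IsProj U P) : LinearMap.IsProj (L ⊔ U) (p + P ∘ₗ (LinearMap.id - p)) := by
  refine ⟨fun m => Submodule.add_mem_sup (hp.map_mem _) (hP.map_mem _), fun m hm => ?_⟩
  obtain ⟨l, hl, u, hu, rfl⟩ := Submodule.mem_sup.1 hm
  simp [hp.map_id l hl, hpU u hu, hP.map_id u hu]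

lemma isProj_map_sub (hp : LinearMap.IsProj L p) {P : M →ₗ[R] M}
    (hP : LinearMap.IsProj U P) (hLU : L ≤ U) :
    LinearMap.IsProj (U.map (LinearMap.id - p)) ((LinearMap.id - p) ∘ₗ P) := by
  refine ⟨fun m => Submodule.mem_map_of_mem (hP.map_mem _), ?_⟩
  rintro _ ⟨u, hu, rfl⟩
  have : P (p u) = p u := hP.map_id _ (hLU (hp.map_mem u))
  simp [hP.map_id u hu, this, hp.map_id _ (hp.map_mem u)]

lemma sup_map_sub (hp : LinearMap.IsProj L p) (hLU : L ≤ U) :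
    L ⊔ U.map (LinearMap.id - p) = U := by
  refine le_antisymm (sup_le hLU ?_) fun u hu => ?_
  · rintro _ ⟨u, hu, rfl⟩
    exact U.sub_mem hu (hLU (hp.map_mem u))
  · have : u = p u + (LinearMap.id - p : M →ₗ[R] M) u := by simp
    rw [this]
    exact Submodule.add_mem_sup (hp.map_mem u) (Submodule.mem_map_of_mem hu)

lemma rankAtStalk_sup (hp : LinearMap.IsProj L p) (hpU : ∀ u ∈ U, p u = 0)
    [Module.Finite R L] [Module.Projective R L] [Module.Finite R U] [Module.Projective R U]
    (q : PrimeSpectrum R) : Module.rankAtStalk (R := R) ↥(L ⊔ U) q =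
      Module.rankAtStalk (R := R) L q + Module.rankAtStalk (R := R) U q := by
  have hinj : Function.Injective (L.subtype.coprod U.subtype) := by
    rw [← LinearMap.ker_eq_bot, LinearMap.ker_eq_bot']
    rintro ⟨l, u⟩ h
    have h' : (l : M) + u = 0 := h
    have hl : (l : M) = 0 := by
      have := congrArg p h'
      rwa [map_add, hp.map_id l l.2, hpU u u.2, map_zero, add_zero] at this
    rw [hl, zero_add] at h'
    exact Prod.ext (Subtype.ext hl) (Subtype.ext h')
  have hr : LinearMap.range (L.subtype.coprod U.subtype) = L ⊔ U := by
    rw [LinearMap.range_coprod, Submodule.range_subtype, Submodule.range_subtype]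
  rw [← hr, ← Module.rankAtStalk_eq_of_equiv (LinearEquiv.ofInjective _ hinj),
    Module.rankAtStalk_prod, Pi.add_apply]

end WedgeLines

/-! ### Rank-two subbundles and their exterior squares -/

section Contraction

variable {R : Type*} [CommRing R] [Algebra ℂ R] {V : Type u} [AddCommGroup V] [Module ℂ V]

lemma wedgeVec_eq_ιMulti (a b : V) : wedgeVec V a b = exteriorPower.ιMulti ℂ 2 ![a, b] := by
  refine Subtype.ext ?_
  simp [wedgeVec, ExteriorAlgebra.ιMulti_apply]

lemma wedgeVec_isAlt : (wedgeVec V).IsAlt := fun a => Subtype.ext (by simp [wedgeVec])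

/-- The wedge product of two sections of `R ⊗ V`. -/
abbrev wedgeR (R : Type*) [CommRing R] [Algebra ℂ R] (V : Type u) [AddCommGroup V] [Module ℂ V] :
    R ⊗[ℂ] V →ₗ[R] R ⊗[ℂ] V →ₗ[R] R ⊗[ℂ] ⋀[ℂ]^2 V :=
  LinearMap.BilinMap.baseChange R (wedgeVec V)

lemma wedgeR_tmul (r s : R) (a b : V) :
    wedgeR R V (r ⊗ₜ a) (s ⊗ₜ b) = (r * s) ⊗ₜ wedgeVec V a b := by
  rfl

lemma wedgeR_isAlt : (wedgeR R V).IsAlt := by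
  have hsymm : ∀ x y : R ⊗[ℂ] V, wedgeR R V x y + wedgeR R V y x = 0 := by
    intro x y
    induction x with
    | zero => simp
    | tmul r a =>
      induction y with
      | zero => simp
      | tmul s b =>
        rw [wedgeR_tmul, wedgeR_tmul, mul_comm s r, ← TensorProduct.tmul_add,
          ← wedgeVec_isAlt.neg b a, add_comm, ← sub_eq_add_neg, sub_self, TensorProduct.tmul_zero]
      | add y z hy hz =>
        rw [map_add, LinearMap.map_add₂, add_add_add_comm, hy, hz, add_zero]
    | add x z hx hz => rw [LinearMap.map_add₂, map_add, add_add_add_comm, hx, hz, add_zero]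
  intro x
  induction x with
  | zero => simp
  | tmul r a => rw [wedgeR_tmul, wedgeVec_isAlt, TensorProduct.tmul_zero]
  | add x y hx hy =>
    rw [map_add, LinearMap.map_add₂, LinearMap.map_add₂, hx, hy, zero_add, add_zero, add_comm,
      hsymm]

/-- The contraction `⋀² V → R ⊗ V` with a linear form `g` on `R ⊗ V`. -/
def contractAux (g : Module.Dual R (R ⊗[ℂ] V)) : ⋀[ℂ]^2 V →ₗ[ℂ] R ⊗[ℂ] V :=
  exteriorPower.alternatingMapLinearEquiv
    { toFun := fun m => g (1 ⊗ₜ m 0) • (1 ⊗ₜ[ℂ] m 1) - g (1 ⊗ₜ m 1) • (1 ⊗ₜ[ℂ] m 0)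
      map_update_add' := by
        intro _ m i x y
        fin_cases i <;> simp [TensorProduct.tmul_add, add_smul] <;> abel
      map_update_smul' := by
        intro _ m i z x
        fin_cases i <;> simp [smul_sub, smul_comm z]
      map_eq_zero_of_eq' := by
        intro m i j h hij
        have : m 0 = m 1 := by
          fin_cases i <;> fin_cases j <;> simp_all
        simp [this] }

lemma contractAux_wedgeVec (g : Module.Dual R (R ⊗[ℂ] V)) (a b : V) :
    contractAux g (wedgeVec V a b) = g (1 ⊗ₜ a) • (1 ⊗ₜ[ℂ] b) - g (1 ⊗ₜ b) • (1 ⊗ₜ[ℂ] a) := by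
  rw [wedgeVec_eq_ιMulti, contractAux, exteriorPower.alternatingMapLinearEquiv_apply_ιMulti]
  rfl

/-- The contraction `R ⊗ ⋀² V → R ⊗ V` with a linear form `g` on `R ⊗ V`, given by
`a ∧ b ↦ g(a) b - g(b) a`. -/
def contract (g : Module.Dual R (R ⊗[ℂ] V)) : R ⊗[ℂ] ⋀[ℂ]^2 V →ₗ[R] R ⊗[ℂ] V :=
  (contractAux g).liftBaseChange R

lemma contract_wedgeR (g : Module.Dual R (R ⊗[ℂ] V)) (x y : R ⊗[ℂ] V) :
    contract g (wedgeR R V x y) = g x • y - g y • x := by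
  have ht : ∀ (r : R) (a : V), r ⊗ₜ[ℂ] a = r • (1 ⊗ₜ a) := fun r a => by
    simp [TensorProduct.smul_tmul']
  induction x with
  | zero => simp
  | tmul r a =>
    induction y with
    | zero => simp
    | tmul s b =>
      rw [wedgeR_tmul, contract, LinearMap.liftBaseChange_tmul, contractAux_wedgeVec, ht r, ht s]
      simp only [map_smul, smul_sub, smul_smul, smul_eq_mul]
      congr 2 <;> ring
    | add y z hy hz =>
      rw [map_add, map_add, hy, hz, map_add, smul_add, add_smul]
      abel
  | add x z hx hz =>
    rw [LinearMap.map_add₂, map_add, hx, hz, map_add, smul_add, add_smul]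
    abel

end Contraction

section WedgeSub

variable {R : Type} [CommRing R] [Algebra ℂ R] {V : Type u} [AddCommGroup V] [Module ℂ V]

lemma isUnit_two (R : Type*) [CommRing R] [Algebra ℂ R] : IsUnit (2 : R) := by
  have := (IsUnit.mk0 (2 : ℂ) two_ne_zero).map (algebraMap ℂ R)
  rwa [map_ofNat] at this

lemma baseChangeMap_wedgeR {S : Type} [CommRing S] [Algebra ℂ S] (f : R →ₐ[ℂ] S)
    (x y : R ⊗[ℂ] V) : baseChangeMap (⋀[ℂ]^2 V) f (wedgeR R V x y) =
      wedgeR S V (baseChangeMap V f x) (baseChangeMap V f y) := by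
  induction x with
  | zero => simp
  | tmul r a =>
    induction y with
    | zero => simp
    | tmul s b => simp only [wedgeR_tmul, baseChangeMap_tmul, map_mul]
    | add y z hy hz => simp only [map_add, hy, hz]
  | add x z hx hz => simp only [map_add, hx, hz, LinearMap.add_apply]

lemma pullback_wedgeSub {S : Type} [CommRing S] [Algebra ℂ S] (f : R →ₐ[ℂ] S)
    (N N' : Submodule R (R ⊗[ℂ] V)) :
    wedgeSub S (pullback f N) (pullback f N') = pullback f (wedgeSub R N N') := by
  refine le_antisymm (Submodule.map₂_le.2 fun x hx y hy => ?_) (pullback_le.2 fun x hx => ?_)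
  · refine pullback_induction (p := fun x => wedgeR S V x y ∈ pullback f (wedgeSub R N N'))
      (fun a ha => ?_) (by simp) (fun x y hx hy => ?_) (fun s x hx => ?_) hx
    · refine pullback_induction (p := fun y => wedgeR S V (baseChangeMap V f a) y ∈
        pullback f (wedgeSub R N N')) (fun b hb => ?_) (by simp) (fun x y hx hy => ?_)
        (fun s x hx => ?_) hy
      · rw [← baseChangeMap_wedgeR]
        exact baseChangeMap_mem_pullback f (Submodule.apply_mem_map₂ _ ha hb)
      · rw [map_add]; exact add_mem hx hy
      · rw [map_smul]; exact Submodule.smul_mem _ _ hx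
    · rw [LinearMap.map_add₂]; exact add_mem hx hy
    · rw [LinearMap.map_smul₂]; exact Submodule.smul_mem _ _ hx
  · rw [wedgeSub, Submodule.map₂_eq_span_image2] at hx
    induction hx using Submodule.span_induction with
    | mem x hx =>
      obtain ⟨a, ha, b, hb, rfl⟩ := hx
      rw [baseChangeMap_wedgeR]
      exact Submodule.apply_mem_map₂ _ (baseChangeMap_mem_pullback f ha)
        (baseChangeMap_mem_pullback f hb)
    | zero => simp
    | add x y _ _ hx hy => rw [map_add]; exact add_mem hx hy
    | smul r x _ hx => rw [baseChangeMap_smul]; exact Submodule.smul_mem _ _ hx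

lemma pullback_wedgeSub_top {S : Type} [CommRing S] [Algebra ℂ S] (f : R →ₐ[ℂ] S)
    (N : Submodule R (R ⊗[ℂ] V)) :
    wedgeSub S (pullback f N) ⊤ = pullback f (wedgeSub R N ⊤) := by
  rw [← pullback_wedgeSub, pullback_top]

lemma exists_isProj_wedgeSub_top {L : Submodule R (R ⊗[ℂ] V)} (hL : IsLine L) :
    ∃ P : R ⊗[ℂ] ⋀[ℂ]^2 V →ₗ[R] R ⊗[ℂ] ⋀[ℂ]^2 V, LinearMap.IsProj (wedgeSub R L ⊤) P := by
  obtain ⟨ι, _, v, f, hv, hf, h1⟩ := hL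
  exact ⟨_, isProj_wedge_top wedgeR_isAlt contract_wedgeR hv hf h1 (isUnit_two R)⟩

variable [Module.Finite ℂ V] [Algebra.FiniteType ℂ R]

/-- For a line bundle `L ⊆ R ⊗ V`, the rank-two subbundles `U ⊇ L` correspond, by `U ↦ ⋀² U`, to
the rank-one subbundles of `L ∧ (R ⊗ V)`. -/
theorem bijOn_wedgeSub_self {L : Submodule R (R ⊗[ℂ] V)} (hL1 : IsSubbundle 1 L) :
    Set.BijOn (fun U => wedgeSub R U U) {U | L ≤ U ∧ IsSubbundle 2 U}
      {M | IsSubbundle 1 M ∧ M ≤ wedgeSub R L ⊤} := by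
  have hL := hL1.isLine
  obtain ⟨p, hp⟩ := hL.exists_isProj
  obtain ⟨ι, _, v, f, hv, hf, h1⟩ := id hL
  have h2 := isUnit_two R
  -- A rank-two subbundle containing `L` is the direct sum of `L` and of a line bundle in `Ker p`.
  have split : ∀ U, L ≤ U → IsSubbundle 2 U → ∃ U', IsLine U' ∧ (∀ u ∈ U', p u = 0) ∧
      U = L ⊔ U' := by
    intro U hLU hU
    obtain ⟨P, hP⟩ := hU.exists_isProj
    have hP' := isProj_map_sub hp hP hLU
    have hpU : ∀ u ∈ U.map (LinearMap.id - p), p u = 0 := by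
      rintro _ ⟨u, -, rfl⟩
      simp [hp.map_id _ (hp.map_mem u)]
    refine ⟨U.map (LinearMap.id - p), isLine_of_isProj hP' fun q => ?_, hpU,
      (sup_map_sub hp hLU).symm⟩
    have := finite_of_isProj hp
    have := projective_of_isProj hp
    have := finite_of_isProj hP'
    have := projective_of_isProj hP'
    have hr := rankAtStalk_sup hp hpU q
    rw [sup_map_sub hp hLU, hU.2.2, hL1.2.2] at hr
    omega
  have join : ∀ U', IsLine U' → (∀ u ∈ U', p u = 0) → IsSubbundle 2 (L ⊔ U') := by
    intro U' hU' hpU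
    obtain ⟨P, hP⟩ := hU'.exists_isProj
    refine isSubbundle_of_isProj (isProj_sup hp hpU hP) fun q => ?_
    have := finite_of_isProj hp
    have := projective_of_isProj hp
    have := finite_of_isProj hP
    have := projective_of_isProj hP
    rw [rankAtStalk_sup hp hpU q, hL1.2.2, hU'.isSubbundle.2.2]
  have wedge_eq : ∀ U', IsLine U' → wedgeSub R (L ⊔ U') (L ⊔ U') = wedgeSub R L U' :=
    fun U' hU' => wedge_sup_self wedgeR_isAlt h2 hL hU'
  refine ⟨?_, ?_, ?_⟩
  · rintro U ⟨hLU, hU⟩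
    obtain ⟨U', hU', hpU, rfl⟩ := split U hLU hU
    simp only [wedge_eq U' hU']
    exact ⟨(IsLine.wedge contract_wedgeR hp hpU hL hU').isSubbundle,
      Submodule.map₂_le_map₂ le_rfl le_top⟩
  · rintro U₁ ⟨hLU₁, hU₁⟩ U₂ ⟨hLU₂, hU₂⟩ h
    obtain ⟨U₁', hU₁', hpU₁, rfl⟩ := split U₁ hLU₁ hU₁
    obtain ⟨U₂', hU₂', hpU₂, rfl⟩ := split U₂ hLU₂ hU₂
    simp only [wedge_eq _ hU₁', wedge_eq _ hU₂'] at h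
    rw [← residual_wedge contract_wedgeR hv h1 hp hpU₁,
      ← residual_wedge contract_wedgeR hv h1 hp hpU₂]
    exact congrArg (fun N => L ⊔ residual contract p f N) h
  · rintro M ⟨hM, hML⟩
    have hlin := isLine_residual wedgeR_isAlt contract_wedgeR hv hf h1 h2 hp hML hM.isLine
    refine ⟨L ⊔ residual contract p f M, ⟨le_sup_left, join _ hlin fun u hu =>
      apply_eq_zero_of_mem_residual hp hu⟩, ?_⟩
    simp only [wedge_eq _ hlin]
    exact wedge_residual wedgeR_isAlt contract_wedgeR hv hf h1 h2 hp hML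

end WedgeSub

/-! ### Isotropic vectors and decomposable bivectors -/

section Isotropic

variable {M : Type*} [AddCommGroup M] [Module ℂ M]

lemma exists_isotropic_combination (q : QuadraticForm ℂ M) (x y : M) :
    ∃ a b : ℂ, (a ≠ 0 ∨ b ≠ 0) ∧ q (a • x + b • y) = 0 := by
  by_cases hy : q y = 0
  · exact ⟨0, 1, Or.inr one_ne_zero, by simpa using hy⟩
  · obtain ⟨s, hs⟩ := IsAlgClosed.exists_eq_mul_self
      (discrim (q y) (QuadraticMap.polar q x y) (q x))
    obtain ⟨b, hb⟩ := exists_quadratic_eq_zero hy ⟨s, hs⟩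
    refine ⟨1, b, Or.inl one_ne_zero, ?_⟩
    rw [QuadraticMap.map_add q, QuadraticMap.polar_smul_left, QuadraticMap.polar_smul_right,
      QuadraticMap.map_smul, QuadraticMap.map_smul]
    simp only [smul_eq_mul]
    linear_combination hb

lemma exists_isotropic (q : QuadraticForm ℂ M) {N : Submodule ℂ M}
    (hN : 2 ≤ Module.finrank ℂ N) : ∃ x ∈ N, x ≠ 0 ∧ q x = 0 := by
  have : Module.Finite ℂ N := Module.finite_of_finrank_pos (by omega)
  have : Nontrivial N := Module.nontrivial_of_finrank_pos (R := ℂ) (by omega)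
  obtain ⟨x, hx⟩ := exists_ne (0 : N)
  obtain ⟨y, hxy⟩ := exists_linearIndependent_pair_of_one_lt_finrank (R := ℂ) (M := N) hN hx
  obtain ⟨s, t, hst, h⟩ := exists_isotropic_combination q (x : M) y
  refine ⟨_, N.add_mem (N.smul_mem s x.2) (N.smul_mem t y.2), fun h0 => ?_, h⟩
  have hpair := LinearIndependent.pair_iff.1 hxy s t (Subtype.ext h0)
  exact hst.elim (fun h => h hpair.1) fun h => h hpair.2

end Isotropic

section Vectors

variable {V : Type u} [AddCommGroup V] [Module ℂ V]

lemma wedgeVec_coe (a b : V) : (wedgeVec V a b : ExteriorAlgebra ℂ V) =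
    ExteriorAlgebra.ι ℂ a * ExteriorAlgebra.ι ℂ b := rfl

lemma exists_dual_eq_one_of_notMem {N : Submodule ℂ V} {u : V} (hu : u ∉ N) :
    ∃ f : Module.Dual ℂ V, f u = 1 ∧ ∀ x ∈ N, f x = 0 := by
  obtain ⟨f, hf, hN⟩ := Submodule.exists_le_ker_of_notMem hu
  refine ⟨(f u)⁻¹ • f, by simp [hf], fun x hx => ?_⟩
  have : f x = 0 := hN hx
  simp [this]

lemma exists_dual_eq_one {v : V} (hv : v ≠ 0) : ∃ f : Module.Dual ℂ V, f v = 1 := by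
  obtain ⟨f, hf, -⟩ := exists_dual_eq_one_of_notMem (N := ⊥) (u := v) (by simpa using hv)
  exact ⟨f, hf⟩

/-- The contraction of an equality `v ∧ a = u ∧ b` with a linear form. -/
lemma wedgeVec_contract (f : Module.Dual ℂ V) {v a u b : V} (h : wedgeVec V v a = wedgeVec V u b) :
    f v • a - f a • v = f u • b - f b • u := by
  have := congrArg (CliffordAlgebra.contractLeft (Q := (0 : QuadraticForm ℂ V)) f)
    (congrArg Subtype.val h)
  rw [wedgeVec_coe, wedgeVec_coe] at this
  rw [CliffordAlgebra.contractLeft_ι_mul, CliffordAlgebra.contractLeft_ι_mul,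
    CliffordAlgebra.contractLeft_ι, CliffordAlgebra.contractLeft_ι, ← Algebra.commutes,
    ← Algebra.commutes, ← Algebra.smul_def, ← Algebra.smul_def, ← map_smul, ← map_smul, ← map_smul,
    ← map_smul, ← map_sub, ← map_sub] at this
  exact (ExteriorAlgebra.ι_inj ℂ _ _).1 this

lemma ker_wedgeVec {v : V} (hv : v ≠ 0) : LinearMap.ker (wedgeVec V v) = ℂ ∙ v := by
  obtain ⟨f, hf⟩ := exists_dual_eq_one hv
  ext a
  rw [LinearMap.mem_ker, Submodule.mem_span_singleton]
  refine ⟨fun h => ⟨f a, ?_⟩, ?_⟩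
  · have := wedgeVec_contract f (v := v) (a := a) (u := 0) (b := 0) (by simpa using h)
    simp only [hf, one_smul, map_zero, smul_zero, sub_zero, sub_eq_zero] at this
    exact this.symm
  · rintro ⟨c, rfl⟩
    rw [map_smul, wedgeVec_isAlt, smul_zero]

variable [Module.Finite ℂ V]

lemma finrank_range_wedgeVec {v : V} (hv : v ≠ 0) :
    Module.finrank ℂ (LinearMap.range (wedgeVec V v)) + 1 = Module.finrank ℂ V := by
  rw [← LinearMap.finrank_range_add_finrank_ker (wedgeVec V v), ker_wedgeVec hv,
    finrank_span_singleton hv]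

/-- For independent `v` and `u`, the sum of `v ∧ V` and `u ∧ V`, which meet in the line of `v ∧ u`,
has dimension `2 dim V - 3`. -/
lemma finrank_range_wedgeVec_sup {v u : V} (hv : v ≠ 0) (hu : u ∉ ℂ ∙ v) :
    2 * Module.finrank ℂ V ≤ Module.finrank ℂ
      ↥(LinearMap.range (wedgeVec V v) ⊔ LinearMap.range (wedgeVec V u)) + 3 := by
  have hu0 : u ≠ 0 := fun h => hu (h ▸ Submodule.zero_mem _)
  obtain ⟨f, hfu, hf⟩ := exists_dual_eq_one_of_notMem hu
  have hfv : f v = 0 := hf v (Submodule.mem_span_singleton_self v)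
  have hle : LinearMap.range (wedgeVec V v) ⊓ LinearMap.range (wedgeVec V u) ≤
      ℂ ∙ wedgeVec V v u := by
    rintro _ ⟨⟨a, rfl⟩, b, hb⟩
    have := wedgeVec_contract f hb
    rw [hfv, hfu, zero_smul, one_smul, zero_sub, sub_eq_iff_eq_add] at this
    rw [← hb, this, map_add, map_neg, map_smul, map_smul, wedgeVec_isAlt, smul_zero, add_zero,
      ← wedgeVec_isAlt.neg v u, smul_neg, neg_neg]
    exact Submodule.smul_mem _ _ (Submodule.mem_span_singleton_self _)
  have h1 := Submodule.finrank_mono hle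
  have h2 := Submodule.finrank_sup_add_finrank_inf_eq (LinearMap.range (wedgeVec V v))
    (LinearMap.range (wedgeVec V u))
  have h3 : Module.finrank ℂ (ℂ ∙ wedgeVec V v u) ≤ 1 := finrank_span_le_card _ |>.trans (by simp)
  have h4 := finrank_range_wedgeVec hv
  have h5 := finrank_range_wedgeVec hu0
  omega

lemma finrank_wedge_two (hV : Module.finrank ℂ V = 5) : Module.finrank ℂ (⋀[ℂ]^2 V) = 10 := by
  rw [exteriorPower.finrank_eq, hV]; rfl

end Vectors

/-! ### Pencils of skew forms and smoothness -/

section Pencil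

variable {V : Type u} [AddCommGroup V] [Module ℂ V]

/-- A pencil of skew forms with `v` in their common kernel contains a nonzero form whose kernel is
larger than `ℂ v`: this is an eigenvalue problem on a complement of `ℂ v`. -/
lemma exists_degenerate_form [Module.Finite ℂ V] (hV : 2 ≤ Module.finrank ℂ V) {v : V}
    {W : Submodule ℂ (⋀[ℂ]^2 V)} (hvW : LinearMap.range (wedgeVec V v) ≤ W)
    (hW : 2 ≤ Module.finrank ℂ W.dualAnnihilator) :
    ∃ ω : Module.Dual ℂ (⋀[ℂ]^2 V), ω ≠ 0 ∧ W ≤ LinearMap.ker ω ∧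
      ∃ u, u ∉ ℂ ∙ v ∧ ∀ x, ω (wedgeVec V u x) = 0 := by
  have : Nontrivial W.dualAnnihilator := Module.nontrivial_of_finrank_pos (R := ℂ) (by omega)
  obtain ⟨ω₁, hω₁⟩ := exists_ne (0 : W.dualAnnihilator)
  obtain ⟨ω₂, hli⟩ := exists_linearIndependent_pair_of_one_lt_finrank (R := ℂ) hW hω₁
  obtain ⟨C, hC⟩ := (ℂ ∙ v).exists_isCompl
  have hCpos : 0 < Module.finrank ℂ C := by
    have h1 := Submodule.finrank_add_eq_of_isCompl hC
    have h2 : Module.finrank ℂ (ℂ ∙ v) ≤ 1 := (finrank_span_le_card _).trans (by simp)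
    omega
  have : Nontrivial C := Module.nontrivial_of_finrank_pos hCpos
  have hnot : ∀ u : C, u ≠ 0 → (u : V) ∉ ℂ ∙ v := fun u hu h =>
    hu (Subtype.ext (Submodule.disjoint_def.1 hC.disjoint _ h u.2))
  -- A form in `W^⊥` kills `u ∧ V` as soon as it kills `u ∧ C`.
  have hker : ∀ ω : W.dualAnnihilator, ∀ u : V, (∀ c ∈ C, ω.1 (wedgeVec V u c) = 0) →
      ∀ x, ω.1 (wedgeVec V u x) = 0 := by
    intro ω u h x
    obtain ⟨a, ha, c, hc, rfl⟩ := Submodule.mem_sup.1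
      (hC.sup_eq_top ▸ Submodule.mem_top : x ∈ (ℂ ∙ v) ⊔ C)
    obtain ⟨s, rfl⟩ := Submodule.mem_span_singleton.1 ha
    have h0 : ω.1 (wedgeVec V v u) = 0 :=
      (Submodule.mem_dualAnnihilator _).1 ω.2 _ (hvW ⟨u, rfl⟩)
    rw [map_add, map_add, h c hc, map_smul, map_smul, ← wedgeVec_isAlt.neg, map_neg, h0]
    simp
  let B : Module.Dual ℂ (⋀[ℂ]^2 V) → C →ₗ[ℂ] Module.Dual ℂ C := fun ω =>
    ((wedgeVec V).compr₂ ω).domRestrict₁₂ C C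
  have hB : ∀ ω (a b : C), B ω a b = ω (wedgeVec V a b) := fun ω a b => rfl
  by_cases hinj : Function.Injective (B ω₁.1)
  · let e : C ≃ₗ[ℂ] Module.Dual ℂ C :=
      LinearEquiv.ofInjectiveOfFinrankEq (B ω₁.1) hinj Subspace.dual_finrank_eq.symm
    obtain ⟨c, hc⟩ := Module.End.exists_eigenvalue (e.symm.toLinearMap ∘ₗ B ω₂.1 : Module.End ℂ C)
    obtain ⟨u, hu⟩ := hc.exists_hasEigenvector
    have hu1 : B ω₂.1 u = c • B ω₁.1 u := by
      have h1 := hu.apply_eq_smul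
      have h2 : e.symm (B ω₂.1 u) = c • u := h1
      rw [LinearEquiv.symm_apply_eq, map_smul] at h2
      exact h2
    refine ⟨(ω₂ - c • ω₁).1, fun h0 => ?_, fun w hw => ?_, u, hnot u hu.2, ?_⟩
    · have := LinearIndependent.pair_iff.1 hli (-c) 1 (by
        rw [neg_smul, one_smul, neg_add_eq_sub]; exact Subtype.ext h0)
      exact one_ne_zero this.2
    · exact (Submodule.mem_dualAnnihilator _).1 (ω₂ - c • ω₁).2 w hw
    · refine hker _ _ fun x hx => ?_
      have := LinearMap.congr_fun hu1 ⟨x, hx⟩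
      rw [LinearMap.smul_apply, hB, hB, smul_eq_mul] at this
      simp [this]
  · obtain ⟨u, hu, hu0⟩ : ∃ u, B ω₁.1 u = 0 ∧ u ≠ 0 := by
      by_contra! h
      exact hinj ((injective_iff_map_eq_zero _).2 h)
    refine ⟨ω₁.1, fun h => hω₁ (Subtype.ext h), fun w hw =>
      (Submodule.mem_dualAnnihilator _).1 ω₁.2 w hw, u, hnot u hu0, hker _ _ fun x hx => ?_⟩
    exact LinearMap.congr_fun hu ⟨x, hx⟩

/-- A skew form on a space of odd dimension is degenerate; here, a form on `V` of dimension `5`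
whose kernel contains two independent vectors has a third one in its kernel. -/
lemma exists_third_kernel_vector (hV : Module.finrank ℂ V = 5) {v u : V}
    {ω : Module.Dual ℂ (⋀[ℂ]^2 V)} (hv0 : v ≠ 0) (huv : u ∉ ℂ ∙ v)
    (hv : ∀ x, ω (wedgeVec V v x) = 0) (hu : ∀ x, ω (wedgeVec V u x) = 0) :
    ∃ c, c ∉ Submodule.span ℂ {v, u} ∧ ∀ x, ω (wedgeVec V c x) = 0 := by
  have : Module.Finite ℂ V := Module.finite_of_finrank_pos (by omega)
  obtain ⟨C, hC⟩ := (Submodule.span ℂ {v, u}).exists_isCompl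
  have hC3 : Module.finrank ℂ C = 3 := by
    have h1 := Submodule.finrank_add_eq_of_isCompl hC
    have h2 : Module.finrank ℂ (Submodule.span ℂ {v, u}) = 2 := by
      have hli : LinearIndependent ℂ ![v, u] :=
        (LinearIndependent.pair_iff' hv0).2 fun a h =>
          huv (Submodule.mem_span_singleton.2 ⟨a, h⟩)
      have := finrank_span_eq_card hli
      rwa [Matrix.range_cons_cons_empty, Fintype.card_fin] at this
    omega
  let b := Module.finBasisOfFinrankEq ℂ C hC3
  let β : V → V → ℂ := fun x y => ω (wedgeVec V x y)
  have hskew : ∀ x y, β x y = -β y x := fun x y => by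
    simp only [β]; rw [← wedgeVec_isAlt.neg, map_neg]
  have hself : ∀ x, β x x = 0 := fun x => by simp only [β]; rw [wedgeVec_isAlt, map_zero]
  have hker : ∀ c : V, β c (b 0) = 0 → β c (b 1) = 0 → β c (b 2) = 0 →
      ∀ x, ω (wedgeVec V c x) = 0 := by
    intro c h0 h1 h2 x
    obtain ⟨y, hy, z, hz, rfl⟩ := Submodule.mem_sup.1
      (hC.sup_eq_top ▸ Submodule.mem_top : x ∈ Submodule.span ℂ {v, u} ⊔ C)
    obtain ⟨s, t, rfl⟩ := Submodule.mem_span_pair.1 hy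
    have hz' := congrArg Subtype.val (b.sum_repr ⟨z, hz⟩)
    rw [Fin.sum_univ_three] at hz'
    simp only [Submodule.coe_add, Submodule.coe_smul] at hz'
    have hcv := hskew c v
    have hcu := hskew c u
    simp only [β] at h0 h1 h2 hcv hcu
    rw [hv] at hcv
    rw [hu] at hcu
    rw [← hz']
    simp [h0, h1, h2, hcv, hcu]
  have hnot : ∀ c : C, c ≠ 0 → (c : V) ∉ Submodule.span ℂ {v, u} := fun c hc h =>
    hc (Subtype.ext (Submodule.disjoint_def.1 hC.disjoint _ h c.2))
  -- The kernel of a skew form on a three-dimensional space is spanned by the vector of its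
  -- `2 × 2` minors.
  let m : C := β (b 1) (b 2) • b 0 - β (b 0) (b 2) • b 1 + β (b 0) (b 1) • b 2
  by_cases hm : m = 0
  · have hli := Fintype.linearIndependent_iff.1 b.linearIndependent
      ![β (b 1) (b 2), -β (b 0) (b 2), β (b 0) (b 1)] (by
        rw [Fin.sum_univ_three, ← hm]
        simp [m, sub_eq_add_neg])
    have h01 : β (b 0) (b 1) = 0 := by simpa using hli 2
    have h02 : β (b 0) (b 2) = 0 := by simpa using hli 1
    exact ⟨b 0, hnot _ (b.ne_zero 0), hker _ (hself _) h01 h02⟩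
  · have hmx : ∀ x, β m x = β (b 1) (b 2) * β (b 0) x - β (b 0) (b 2) * β (b 1) x +
        β (b 0) (b 1) * β (b 2) x := fun x => by simp [m, β]
    refine ⟨m, hnot m hm, hker _ ?_ ?_ ?_⟩
    · rw [hmx, hself, hskew (b 1) (b 0), hskew (b 2) (b 0)]; ring
    · rw [hmx, hself, hskew (b 2) (b 1)]; ring
    · rw [hmx, hself]; ring

/-- On a smooth `X`, no two independent forms in `W^⊥` have a common kernel vector `v`. Otherwise
`n = 3` and `v ∧ V ⊆ W`, and some nonzero `ω ∈ W^⊥` has a kernel of dimension at least `3`. This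
contains a vector `t`, independent of `v`, such that `Q (v ∧ t) = 0`, so that `[v ∧ t] ∈ X`. As `ω`
vanishes on the tangent space `v ∧ V + t ∧ V` to the cone over the Grassmannian, the latter does not
meet `W` transversally, and the tangent space to the cone over `X` has dimension at least `5`. -/
theorem finrank_wedge_sup_ge (hV : Module.finrank ℂ V = 5) {n : ℕ}
    (hn : n = 3 ∨ n = 4 ∨ n = 5) {W : Submodule ℂ (⋀[ℂ]^2 V)} (hW : Module.finrank ℂ W = n + 5)
    {Q : QuadraticForm ℂ (⋀[ℂ]^2 V)} (hX : IsSmoothOfDim n W Q) {v : V} (hv : v ≠ 0) :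
    9 ≤ Module.finrank ℂ ↥(LinearMap.range (wedgeVec V v) ⊔ W) := by
  have : Module.Finite ℂ V := Module.finite_of_finrank_pos (by omega)
  have hT := finrank_wedge_two hV
  have hWle := Submodule.finrank_mono (le_sup_right : W ≤ LinearMap.range (wedgeVec V v) ⊔ W)
  by_contra! hlt
  have hn3 : n = 3 := by omega
  subst hn3
  have hvW : LinearMap.range (wedgeVec V v) ≤ W := by
    have : W = LinearMap.range (wedgeVec V v) ⊔ W :=
      Submodule.eq_of_le_of_finrank_le le_sup_right (by omega)
    rw [this]; exact le_sup_left
  have hann := Subspace.finrank_add_finrank_dualAnnihilator_eq W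
  obtain ⟨ω, hω0, hωW, u, huv, hu⟩ := exists_degenerate_form (by omega) hvW (by omega)
  have hωv : ∀ x, ω (wedgeVec V v x) = 0 := fun x => hωW (hvW ⟨x, rfl⟩)
  obtain ⟨c, hcvu, hc⟩ := exists_third_kernel_vector hV hv huv hωv hu
  obtain ⟨s, r, hsr, hQ⟩ := exists_isotropic_combination Q (wedgeVec V v u) (wedgeVec V v c)
  set t := s • u + r • c with ht
  have hwt : wedgeVec V v t = s • wedgeVec V v u + r • wedgeVec V v c := by simp [ht]
  have htv : t ∉ ℂ ∙ v := by
    intro h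
    obtain ⟨a, ha⟩ := Submodule.mem_span_singleton.1 h
    have hr : r = 0 := by
      by_contra hr
      refine hcvu (Submodule.mem_span_pair.2 ⟨r⁻¹ * a, -(r⁻¹ * s), ?_⟩)
      rw [mul_smul, ha, ht, smul_add, smul_smul, smul_smul, inv_mul_cancel₀ hr, one_smul, neg_smul]
      abel
    have hs : s ≠ 0 := hsr.resolve_right (not_not.2 hr)
    refine huv (Submodule.mem_span_singleton.2 ⟨s⁻¹ * a, ?_⟩)
    rw [mul_smul, ha, ht, hr, zero_smul, add_zero, smul_smul, inv_mul_cancel₀ hs, one_smul]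
  have hωt : ∀ x, ω (wedgeVec V t x) = 0 := fun x => by simp [ht, hu, hc]
  have hw0 : wedgeVec V v t ≠ 0 := fun h => by
    have : t ∈ LinearMap.ker (wedgeVec V v) := h
    rw [ker_wedgeVec hv] at this
    exact htv this
  have hswap : ∀ a b : V, ExteriorAlgebra.ι ℂ a * ExteriorAlgebra.ι ℂ b =
      -(ExteriorAlgebra.ι ℂ b * ExteriorAlgebra.ι ℂ a) := fun a b =>
    eq_neg_of_add_eq_zero_left (ExteriorAlgebra.ι_add_mul_swap a b)
  have hS : LinearMap.range (wedgeVec V v) ⊔ LinearMap.range (wedgeVec V t) ≤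
      LinearMap.ker (wedge V 2 2 (wedgeVec V v t)) := by
    refine sup_le ?_ ?_
    · rintro _ ⟨x, rfl⟩
      refine Subtype.ext ?_
      change ExteriorAlgebra.ι ℂ v * ExteriorAlgebra.ι ℂ t *
        (ExteriorAlgebra.ι ℂ v * ExteriorAlgebra.ι ℂ x) = 0
      rw [hswap v t, neg_mul, mul_assoc, ← mul_assoc (ExteriorAlgebra.ι ℂ v),
        ExteriorAlgebra.ι_sq_zero, zero_mul, mul_zero, neg_zero]
    · rintro _ ⟨x, rfl⟩
      refine Subtype.ext ?_
      change ExteriorAlgebra.ι ℂ v * ExteriorAlgebra.ι ℂ t *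
        (ExteriorAlgebra.ι ℂ t * ExteriorAlgebra.ι ℂ x) = 0
      rw [mul_assoc, ← mul_assoc (ExteriorAlgebra.ι ℂ t), ExteriorAlgebra.ι_sq_zero, zero_mul,
        mul_zero]
  set S := LinearMap.range (wedgeVec V v) ⊔ LinearMap.range (wedgeVec V t) with hSdef
  have hwS : wedgeVec V v t ∈ S := Submodule.mem_sup_left ⟨t, rfl⟩
  have htan := hX _ hw0 (hvW ⟨t, rfl⟩) (hS hwS) (by rw [hwt]; exact hQ)
  have hle : (W ⊓ S) ⊓ LinearMap.ker (Q.polarBilin (wedgeVec V v t)) ≤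
      tangentCone W Q (wedgeVec V v t) :=
    inf_le_inf_right _ (inf_le_inf_left _ hS)
  have h1 := Submodule.finrank_mono hle
  have hωS : S ≤ LinearMap.ker ω := by
    refine sup_le ?_ ?_
    · rintro _ ⟨x, rfl⟩; exact hωv x
    · rintro _ ⟨x, rfl⟩; exact hωt x
  have h2 := Submodule.finrank_mono (sup_le hωW hωS)
  have h3 := Module.Dual.finrank_ker_add_one_of_ne_zero hω0
  have h4 := Submodule.finrank_sup_add_finrank_inf_eq W S
  have h5 := finrank_range_wedgeVec_sup hv htv
  rw [← hSdef] at h5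
  have h6 := Submodule.finrank_sup_add_finrank_inf_eq (W ⊓ S)
    (LinearMap.ker (Q.polarBilin (wedgeVec V v t)))
  have h7 := Submodule.finrank_le ((W ⊓ S) ⊔ LinearMap.ker (Q.polarBilin (wedgeVec V v t)))
  have h8 := LinearMap.finrank_range_add_finrank_ker (Q.polarBilin (wedgeVec V v t))
  have h9 := Submodule.finrank_le (LinearMap.range (Q.polarBilin (wedgeVec V v t)))
  rw [Module.finrank_self] at h9
  omega

end Pencil

/-! ### Complex points -/

section ComplexPoints

variable {T : Type u} [AddCommGroup T] [Module ℂ T]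

lemma baseChange_self_eq_map (N : Submodule ℂ T) :
    N.baseChange ℂ = N.map (TensorProduct.lid ℂ T).symm.toLinearMap := by
  rw [Submodule.baseChange_eq_span]
  have : (Submodule.map (TensorProduct.mk ℂ ℂ T 1) N : Set (ℂ ⊗[ℂ] T)) =
      (N.map (TensorProduct.lid ℂ T).symm.toLinearMap : Submodule ℂ (ℂ ⊗[ℂ] T)) := by
    ext; simp
  rw [this, Submodule.span_eq]

lemma finrank_baseChange_self (N : Submodule ℂ T) :
    Module.finrank ℂ (N.baseChange ℂ) = Module.finrank ℂ N := by
  rw [baseChange_self_eq_map]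
  exact LinearEquiv.finrank_map_eq _ N

lemma baseChange_self_sup (N N' : Submodule ℂ T) :
    (N ⊔ N').baseChange ℂ = N.baseChange ℂ ⊔ N'.baseChange ℂ := by
  simp only [baseChange_self_eq_map, Submodule.map_sup]

lemma baseChange_self_inf (N N' : Submodule ℂ T) :
    (N ⊓ N').baseChange ℂ = N.baseChange ℂ ⊓ N'.baseChange ℂ := by
  simp only [baseChange_self_eq_map]
  exact Submodule.map_inf _ (TensorProduct.lid ℂ T).symm.injective

lemma tmul_one_mem_baseChange_self {N : Submodule ℂ T} {t : T} :
    (1 : ℂ) ⊗ₜ[ℂ] t ∈ N.baseChange ℂ ↔ t ∈ N := by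
  rw [baseChange_self_eq_map]
  exact Submodule.mem_map_equiv _ |>.trans (by simp)

lemma closedPoint_mk {v : T} (hv : v ≠ 0) :
    closedPoint (Projectivization.mk ℂ v hv) = ℂ ∙ ((1 : ℂ) ⊗ₜ[ℂ] v) := by
  rw [closedPoint, Projectivization.submodule_mk, Submodule.baseChange_span, Set.image_singleton]
  rfl

lemma isSubbundle_closedPoint [Module.Finite ℂ T] (p : ℙ ℂ T) : IsSubbundle 1 (closedPoint p) := by
  rw [isSubbundle_iff_finrank, closedPoint, finrank_baseChange_self,
    Projectivization.finrank_submodule]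

lemma exists_closedPoint_eq [Module.Finite ℂ T] {L : Submodule ℂ (ℂ ⊗[ℂ] T)}
    (hL : IsSubbundle 1 L) :
    ∃ (v : T) (hv : v ≠ 0), L = closedPoint (Projectivization.mk ℂ v hv) := by
  obtain ⟨y, hy0, hy⟩ := finrank_eq_one_iff'.1 (isSubbundle_iff_finrank.1 hL)
  refine ⟨TensorProduct.lid ℂ T y, fun h => hy0 (Subtype.ext (by simpa using h)), ?_⟩
  rw [closedPoint_mk]
  have h1 : (1 : ℂ) ⊗ₜ[ℂ] TensorProduct.lid ℂ T y = y := by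
    rw [← TensorProduct.lid_symm_apply, LinearEquiv.symm_apply_apply]
  rw [h1]
  refine le_antisymm (fun x hx => ?_) ((Submodule.span_singleton_le_iff_mem _ _).2 y.2)
  obtain ⟨c, hc⟩ := hy ⟨x, hx⟩
  exact Submodule.mem_span_singleton.2 ⟨c, congrArg Subtype.val hc⟩

variable {V : Type u} [AddCommGroup V] [Module ℂ V]

lemma wedgeSub_closedPoint_top {v : V} (hv : v ≠ 0) :
    wedgeSub ℂ (closedPoint (Projectivization.mk ℂ v hv)) ⊤ =
      (LinearMap.range (wedgeVec V v)).baseChange ℂ := by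
  rw [closedPoint_mk]
  refine le_antisymm (Submodule.map₂_le.2 fun x hx y _ => ?_) ?_
  · obtain ⟨c, rfl⟩ := Submodule.mem_span_singleton.1 hx
    rw [LinearMap.map_smul₂]
    refine Submodule.smul_mem _ _ ?_
    have : y = (1 : ℂ) ⊗ₜ[ℂ] TensorProduct.lid ℂ V y := by
      rw [← TensorProduct.lid_symm_apply, LinearEquiv.symm_apply_apply]
    rw [this]
    change wedgeR ℂ V _ _ ∈ _
    rw [wedgeR_tmul, one_mul, tmul_one_mem_baseChange_self]
    exact ⟨_, rfl⟩
  · rw [Submodule.baseChange_eq_span, Submodule.span_le]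
    rintro _ ⟨_, ⟨a, rfl⟩, rfl⟩
    have : TensorProduct.mk ℂ ℂ (⋀[ℂ]^2 V) 1 (wedgeVec V v a) =
        wedgeR ℂ V (1 ⊗ₜ v) (1 ⊗ₜ a) := by
      rw [wedgeR_tmul, one_mul]; rfl
    rw [SetLike.mem_coe, this]
    exact Submodule.apply_mem_map₂ _ (Submodule.mem_span_singleton_self _) trivial

lemma wedgeBundle_closedPoint (W : Submodule ℂ (⋀[ℂ]^2 V)) {v : V} (hv : v ≠ 0) :
    wedgeBundle W ℂ (closedPoint (Projectivization.mk ℂ v hv)) =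
      (LinearMap.range (wedgeVec V v) ⊓ W).baseChange ℂ := by
  rw [wedgeBundle, wedgeSub_closedPoint_top, baseChange_self_inf]

variable [Module.Finite ℂ V]

/-- The point `[v]` lies in `Σ₁(X)` if and only if some nonzero form in `W^⊥` kills `v ∧ V`. -/
lemma closedPoint_mem_Sigma1 {W : Submodule ℂ (⋀[ℂ]^2 V)} {v : V} (hv : v ≠ 0) :
    closedPoint (Projectivization.mk ℂ v hv) ∈ Sigma1 W ℂ ↔
      LinearMap.range (wedgeVec V v) ⊔ W ≠ ⊤ := by
  constructor
  · rintro ⟨-, D, hD, hDW, hDL⟩ htop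
    rw [wedgeSub_closedPoint_top] at hDL
    have hbot : D = ⊥ := by
      refine (Submodule.eq_bot_iff _).2 fun δ hδ => LinearMap.ext fun x => ?_
      have hx : x ∈ (LinearMap.range (wedgeVec V v)).baseChange ℂ ⊔ W.baseChange ℂ := by
        rw [← baseChange_self_sup, htop, Submodule.baseChange_top]; trivial
      obtain ⟨a, ha, b, hb, rfl⟩ := Submodule.mem_sup.1 hx
      rw [map_add, (Submodule.mem_dualAnnihilator _).1 (hDL hδ) a ha,
        (Submodule.mem_dualAnnihilator _).1 (hDW hδ) b hb, LinearMap.zero_apply, add_zero]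
    have := isSubbundle_iff_finrank.1 hD
    rw [hbot, finrank_bot] at this
    exact zero_ne_one this
  · intro h
    have h' : (LinearMap.range (wedgeVec V v) ⊔ W).baseChange ℂ < ⊤ := by
      refine lt_top_iff_ne_top.2 fun h0 => h (eq_top_iff.2 fun x _ => ?_)
      rw [← tmul_one_mem_baseChange_self, h0]; trivial
    obtain ⟨δ, hδ, hle⟩ := Submodule.exists_le_ker_of_lt_top _ h'
    rw [baseChange_self_sup] at hle
    have hmem : ∀ N : Submodule ℂ (ℂ ⊗[ℂ] ⋀[ℂ]^2 V), N ≤ LinearMap.ker δ →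
        ℂ ∙ δ ≤ N.dualAnnihilator := fun N hN =>
      (Submodule.span_singleton_le_iff_mem _ _).2
        ((Submodule.mem_dualAnnihilator _).2 fun x hx => hN hx)
    refine ⟨isSubbundle_closedPoint _, ℂ ∙ δ, isSubbundle_iff_finrank.2 (finrank_span_singleton hδ),
      hmem _ (le_sup_right.trans hle), hmem _ ?_⟩
    rw [wedgeSub_closedPoint_top]
    exact le_sup_left.trans hle

end ComplexPoints

/-! ### The bundle of the spaces `(v ∧ V) ∩ W` -/

section DualLines

lemma IsLine.map {R M M' : Type*} [CommRing R] [AddCommGroup M] [Module R M] [AddCommGroup M']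
    [Module R M'] {N : Submodule R M} (h : IsLine N) (e : M ≃ₗ[R] M') :
    IsLine (N.map e.toLinearMap) := by
  obtain ⟨ι, _, v, f, hv, hf, h1⟩ := h
  refine ⟨ι, inferInstance, fun i => e (v i), fun i => f i ∘ₗ e.symm.toLinearMap,
    fun i => Submodule.mem_map_of_mem (hv i), ?_, by simpa using h1⟩
  rintro i _ ⟨n, hn, rfl⟩ _ ⟨n', hn', rfl⟩
  simp [← map_smul, hf i n hn n' hn']

lemma IsSubbundle.of_map {R M M' : Type*} [CommRing R] [AddCommGroup M] [Module R M]
    [AddCommGroup M'] [Module R M'] {r : ℕ} {N : Submodule R M} (e : M ≃ₗ[R] M')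
    (h : IsSubbundle r (N.map e.toLinearMap)) : IsSubbundle r N := by
  have e' : (M ⧸ N) ≃ₗ[R] M' ⧸ N.map e.toLinearMap := Submodule.Quotient.equiv _ _ e rfl
  obtain ⟨h1, h2, h3⟩ := h
  exact ⟨Module.Finite.equiv e'.symm, Module.Projective.of_equiv e'.symm, fun p => by
    rw [Module.rankAtStalk_eq_of_equiv (e.submoduleMap N)]; exact h3 p⟩

variable {R S : Type} [CommRing R] [Algebra ℂ R] [CommRing S] [Algebra ℂ S]
  {T : Type u} [AddCommGroup T] [Module ℂ T] [Module.Finite ℂ T]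

lemma IsLine.isSubbundle_dual [Algebra.FiniteType ℂ R]
    {D : Submodule R (Module.Dual R (R ⊗[ℂ] T))} (h : IsLine D) : IsSubbundle 1 D := by
  let b := Algebra.TensorProduct.basis R (Module.finBasis ℂ T)
  let e : Module.Dual R (R ⊗[ℂ] T) ≃ₗ[R] R ⊗[ℂ] T := b.dualBasis.equivFun ≪≫ₗ b.equivFun.symm
  exact .of_map e (h.map e).isSubbundle

/-- A frame of a line of linear forms, the functionals being evaluations. -/
lemma IsSubbundle.exists_dual_frame {D : Submodule R (Module.Dual R (R ⊗[ℂ] T))}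
    (hD : IsSubbundle 1 D) : ∃ (ι : Type) (_ : Fintype ι) (δ : ι → Module.Dual R (R ⊗[ℂ] T))
      (μ : ι → R ⊗[ℂ] T), (∀ i, δ i ∈ D) ∧
      (∀ i, ∀ d ∈ D, ∀ d' ∈ D, d (μ i) • d' = d' (μ i) • d) ∧ ∑ i, δ i (μ i) = 1 := by
  obtain ⟨ι, _, δ, F, hδ, hF, h1⟩ := hD.isLine
  refine ⟨ι, inferInstance, δ, fun i => (Module.evalEquiv R _).symm (F i), hδ, ?_, ?_⟩
  · intro i d hd d' hd'
    simpa using hF i d hd d' hd'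
  · simpa using h1

/-- The forms obtained by base change from a frame of the line `D` of skew forms over `R` span the
required line of skew forms over `S`. -/
lemma Sigma1_pullback {V : Type u} [AddCommGroup V] [Module ℂ V] [Module.Finite ℂ V]
    [Algebra.FiniteType ℂ S] {W : Submodule ℂ (⋀[ℂ]^2 V)} (f : R →ₐ[ℂ] S)
    {L : Submodule R (R ⊗[ℂ] V)} (hL : L ∈ Sigma1 W R) : pullback f L ∈ Sigma1 W S := by
  obtain ⟨hL1, D, hD, hDW, hDL⟩ := hL
  obtain ⟨ι, _, δ, μ, hδ, hμ, h1⟩ := hD.exists_dual_frame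
  have hann : ∀ N : Submodule R (R ⊗[ℂ] ⋀[ℂ]^2 V), D ≤ N.dualAnnihilator →
      Submodule.span S (Set.range fun i => extendDual f (δ i)) ≤
        (pullback f N).dualAnnihilator := by
    intro N hN
    rw [Submodule.span_le]
    rintro _ ⟨i, rfl⟩
    refine (Submodule.mem_dualAnnihilator _).2 fun y hy => ?_
    have hle : pullback f N ≤ LinearMap.ker (extendDual f (δ i)) := pullback_le.2 fun x hx => by
      rw [LinearMap.mem_ker, extendDual_baseChangeMap,
        (Submodule.mem_dualAnnihilator _).1 (hN (hδ i)) x hx, map_zero]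
    exact hle hy
  refine ⟨hL1.pullback f, _, IsLine.isSubbundle_dual ?_, (hann _ hDW).trans_eq ?_,
    (hann _ hDL).trans_eq ?_⟩
  · refine ⟨ι, inferInstance, fun i => extendDual f (δ i),
      fun i => Module.Dual.eval S _ (baseChangeMap _ f (μ i)),
      fun i => Submodule.subset_span ⟨i, rfl⟩, ?_, by simp [← map_sum, h1]⟩
    intro i d hd d' hd'
    simp only [Module.Dual.eval_apply]
    induction hd using Submodule.span_induction with
    | zero => simp
    | add a b _ _ ha hb => rw [LinearMap.add_apply, add_smul, ha, hb, smul_add]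
    | smul s a _ ha => rw [LinearMap.smul_apply, smul_assoc, ha, smul_comm]
    | mem d hd =>
      obtain ⟨j, rfl⟩ := hd
      induction hd' using Submodule.span_induction with
      | zero => simp
      | add a b _ _ ha hb => rw [LinearMap.add_apply, add_smul, smul_add, ha, hb]
      | smul s a _ ha => rw [LinearMap.smul_apply, smul_assoc, ← ha, smul_comm]
      | mem d' hd' =>
        obtain ⟨k, rfl⟩ := hd'
        refine linearMap_ext_baseChangeMap (f := f) fun y => ?_
        have := LinearMap.congr_fun (hμ i _ (hδ j) _ (hδ k)) y
        simp only [LinearMap.smul_apply, smul_eq_mul, extendDual_baseChangeMap, ← map_mul] at this ⊢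
        rw [this]
  · rw [pullback_baseChange]
  · rw [pullback_wedgeSub_top]

end DualLines

section Bundle

variable {R S : Type} [CommRing R] [Algebra ℂ R] [CommRing S] [Algebra ℂ S]
  {V : Type u} [AddCommGroup V] [Module ℂ V] [Module.Finite ℂ V]
  {W : Submodule ℂ (⋀[ℂ]^2 V)} {L : Submodule R (R ⊗[ℂ] V)}

lemma exists_isProj_baseChange {T : Type u} [AddCommGroup T] [Module ℂ T] (W : Submodule ℂ T)
    (R : Type) [CommRing R] [Algebra ℂ R] :
    ∃ P : R ⊗[ℂ] T →ₗ[R] R ⊗[ℂ] T, LinearMap.IsProj (W.baseChange R) P := by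
  obtain ⟨P, hP⟩ := exists_isProj_of_field (W.baseChange ℂ)
  have := isProj_pullback (Algebra.ofId ℂ R) hP
  rw [pullback_baseChange] at this
  exact ⟨_, this⟩

lemma exists_isProj_wedgeBundle (hL : IsSubbundle 1 L)
    (hs : ∃ P, LinearMap.IsProj (wedgeSub R L ⊤ ⊔ W.baseChange R)
      (P : R ⊗[ℂ] ⋀[ℂ]^2 V →ₗ[R] R ⊗[ℂ] ⋀[ℂ]^2 V)) :
    ∃ P : R ⊗[ℂ] ⋀[ℂ]^2 V →ₗ[R] R ⊗[ℂ] ⋀[ℂ]^2 V, LinearMap.IsProj (wedgeBundle W R L) P := by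
  obtain ⟨P, hP⟩ := exists_isProj_wedgeSub_top hL.isLine
  obtain ⟨P', hP'⟩ := exists_isProj_baseChange W R
  obtain ⟨H, hH⟩ := hs
  obtain ⟨s, t, hs, ht, hst⟩ := exists_sup_splitting hP hP' hH
  exact ⟨_, isProj_inf hP hP' hs ht fun m hm => by rw [hst, hH.map_id m hm]⟩

lemma wedgeBundle_pullback (hL : IsSubbundle 1 L)
    (hs : ∃ P, LinearMap.IsProj (wedgeSub R L ⊤ ⊔ W.baseChange R)
      (P : R ⊗[ℂ] ⋀[ℂ]^2 V →ₗ[R] R ⊗[ℂ] ⋀[ℂ]^2 V)) (f : R →ₐ[ℂ] S) :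
    wedgeBundle W S (pullback f L) = pullback f (wedgeBundle W R L) := by
  obtain ⟨P, hP⟩ := exists_isProj_wedgeSub_top hL.isLine
  obtain ⟨P', hP'⟩ := exists_isProj_baseChange W R
  obtain ⟨H, hH⟩ := hs
  rw [wedgeBundle, wedgeBundle, pullback_inf f hP hP' hH, pullback_baseChange,
    pullback_wedgeSub_top]

/-- The dimension of `(v ∧ V) ∩ W`. -/
lemma finrank_wedgeBundle_closedPoint (hV : Module.finrank ℂ V = 5) {v : V} (hv : v ≠ 0) :
    Module.finrank ℂ (wedgeBundle W ℂ (closedPoint (Projectivization.mk ℂ v hv))) +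
      Module.finrank ℂ ↥(LinearMap.range (wedgeVec V v) ⊔ W) = 4 + Module.finrank ℂ W := by
  rw [wedgeBundle_closedPoint, finrank_baseChange_self]
  have h1 := Submodule.finrank_sup_add_finrank_inf_eq (LinearMap.range (wedgeVec V v)) W
  have h2 := finrank_range_wedgeVec hv
  omega

variable [Algebra.FiniteType ℂ R]

/-- If `(L ∧ V) + W` is a subbundle, `(L ∧ V) ∩ W` is one too, and its rank can be read off at the
closed points. -/
lemma isSubbundle_wedgeBundle (hV : Module.finrank ℂ V = 5) {r : ℕ} (hL : IsSubbundle 1 L)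
    (hs : ∃ P, LinearMap.IsProj (wedgeSub R L ⊤ ⊔ W.baseChange R)
      (P : R ⊗[ℂ] ⋀[ℂ]^2 V →ₗ[R] R ⊗[ℂ] ⋀[ℂ]^2 V))
    (hr : ∀ (x : R →ₐ[ℂ] ℂ) (v : V) (hv : v ≠ 0),
      pullback x L = closedPoint (Projectivization.mk ℂ v hv) →
      r + Module.finrank ℂ ↥(LinearMap.range (wedgeVec V v) ⊔ W) = 4 + Module.finrank ℂ W) :
    IsSubbundle r (wedgeBundle W R L) := by
  obtain ⟨P, hP⟩ := exists_isProj_wedgeBundle hL hs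
  refine isSubbundle_of_finrank_pullback hP fun x => ?_
  obtain ⟨v, hv, hLv⟩ := exists_closedPoint_eq (hL.pullback x)
  rw [← wedgeBundle_pullback hL hs, hLv]
  have h1 := finrank_wedgeBundle_closedPoint (W := W) hV hv
  have h2 := hr x v hv hLv
  omega

/-- Off `Σ₁(X)`, the subbundles `L ∧ V` and `W` together span `⋀² V`. -/
lemma wedgeSub_sup_eq_top (hL : L ∈ Sigma1Compl W R) :
    wedgeSub R L ⊤ ⊔ W.baseChange R = ⊤ := by
  refine eq_top_iff.2 (le_of_pullback_le (LinearMap.IsProj.top R _) le_top fun x => ?_)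
  obtain ⟨v, hv, hLv⟩ := exists_closedPoint_eq (hL.1.pullback x)
  have h := hL.2 x
  rw [hLv, closedPoint_mem_Sigma1, not_not] at h
  rw [pullback_sup, pullback_baseChange, ← pullback_wedgeSub_top, hLv, wedgeSub_closedPoint_top,
    ← baseChange_self_sup, h, Submodule.baseChange_top]
  exact le_top

/-- Over `Σ₁(X)`, the subbundles `L ∧ V` and `W` together span the kernel of the line `D` of forms
in the definition of `Σ₁(X)`, a subbundle of corank one. -/
lemma exists_isProj_wedgeSub_sup (hV : Module.finrank ℂ V = 5)
    (h9 : ∀ v : V, v ≠ 0 → 9 ≤ Module.finrank ℂ ↥(LinearMap.range (wedgeVec V v) ⊔ W))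
    (hL : L ∈ Sigma1 W R) :
    ∃ P, LinearMap.IsProj (wedgeSub R L ⊤ ⊔ W.baseChange R)
      (P : R ⊗[ℂ] ⋀[ℂ]^2 V →ₗ[R] R ⊗[ℂ] ⋀[ℂ]^2 V) := by
  obtain ⟨hL1, D, hD, hDW, hDL⟩ := hL
  obtain ⟨ι, _, δ, μ, hδ, hμ, h1⟩ := hD.exists_dual_frame
  -- The endomorphism `E` with kernel `D^⊥`, an idempotent that every form in `D` factors through.
  let E : R ⊗[ℂ] ⋀[ℂ]^2 V →ₗ[R] R ⊗[ℂ] ⋀[ℂ]^2 V := ∑ i, (δ i).smulRight (μ i)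
  have hE : ∀ m, E m = ∑ i, δ i m • μ i := fun m => by simp [E]
  have hδE : ∀ d ∈ D, ∀ m, d (E m) = d m := by
    intro d hd m
    have h := sum_smul_eq_self_of_frame (f := fun i => Module.Dual.eval R _ (μ i)) hδ hμ h1 hd
    conv_rhs => rw [← h]
    simp [hE, mul_comm]
  have hH : LinearMap.IsProj (LinearMap.ker E) (LinearMap.id - E) := by
    refine ⟨fun m => ?_, fun m hm => ?_⟩
    · rw [LinearMap.mem_ker, LinearMap.sub_apply, map_sub, LinearMap.id_apply, sub_eq_zero,
        hE (E m)]
      exact (hE m).trans (Finset.sum_congr rfl fun i _ => by rw [hδE _ (hδ i)])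
    · rw [LinearMap.sub_apply, LinearMap.mem_ker.1 hm, sub_zero, LinearMap.id_apply]
  have hle : wedgeSub R L ⊤ ⊔ W.baseChange R ≤ LinearMap.ker E := by
    have : ∀ N : Submodule R (R ⊗[ℂ] ⋀[ℂ]^2 V), D ≤ N.dualAnnihilator → N ≤ LinearMap.ker E :=
      fun N hN n hn => by
        rw [LinearMap.mem_ker, hE]
        exact Finset.sum_eq_zero fun i _ => by
          rw [(Submodule.mem_dualAnnihilator _).1 (hN (hδ i)) n hn, zero_smul]
    exact sup_le (this _ hDL) (this _ hDW)
  have heq : wedgeSub R L ⊤ ⊔ W.baseChange R = LinearMap.ker E := by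
    refine le_antisymm hle (le_of_pullback_le hH hle fun x => ?_)
    have hne : pullback x (LinearMap.ker E) ≠ ⊤ := by
      intro htop
      have hz : ∀ i y, extendDual x (δ i) y = 0 := by
        intro i y
        have hk : pullback x (LinearMap.ker E) ≤ LinearMap.ker (extendDual x (δ i)) :=
          pullback_le.2 fun m hm => by
            rw [LinearMap.mem_ker, extendDual_baseChangeMap, ← hδE _ (hδ i),
              LinearMap.mem_ker.1 hm, map_zero, map_zero]
        exact hk (htop ▸ Submodule.mem_top)
      have h0 : x (∑ i, δ i (μ i)) = 0 := by
        rw [map_sum]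
        exact Finset.sum_eq_zero fun i _ => by rw [← extendDual_baseChangeMap, hz]
      rw [h1, map_one] at h0
      exact one_ne_zero h0
    obtain ⟨v, hv, hLv⟩ := exists_closedPoint_eq (hL1.pullback x)
    have hdim : 9 ≤ Module.finrank ℂ (pullback x (wedgeSub R L ⊤ ⊔ W.baseChange R)) := by
      rw [pullback_sup, pullback_baseChange, ← pullback_wedgeSub_top, hLv,
        wedgeSub_closedPoint_top, ← baseChange_self_sup, finrank_baseChange_self]
      exact h9 v hv
    have hlt := Submodule.finrank_lt hne
    rw [Module.finrank_baseChange, finrank_wedge_two hV] at hlt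
    exact (Submodule.eq_of_le_of_finrank_le (pullback_mono x hle) (by omega)).ge
  exact ⟨_, heq ▸ hH⟩

end Bundle

section RelativeQuadric

variable {V : Type u} [AddCommGroup V] [Module ℂ V] [Module.Finite ℂ V]
  {W : Submodule ℂ (⋀[ℂ]^2 V)} {Q : QuadraticForm ℂ (⋀[ℂ]^2 V)}

/-- The bijection `(L, U) ↦ ⋀² U` from `P(𝒰_X)` to the quadric `Q = 0` in `P((L ∧ V) ∩ W)`. -/
lemma bijOn_PUPoints {R : Type} [CommRing R] [Algebra ℂ R] [Algebra.FiniteType ℂ R]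
    {L : Submodule R (R ⊗[ℂ] V)} (hL : IsSubbundle 1 L) :
    Set.BijOn (fun U => wedgeSub R U U) {U | (L, U) ∈ PUPoints W Q R}
      {M | IsSubbundle 1 M ∧ M ≤ wedgeBundle W R L ∧ ∀ x ∈ M, Q.baseChange R x = 0} := by
  obtain ⟨hmaps, hinj, hsurj⟩ := bijOn_wedgeSub_self hL
  refine ⟨?_, ?_, ?_⟩
  · rintro U ⟨-, hLU, hU, hUW, hUQ⟩
    have h := hmaps (show U ∈ {U | L ≤ U ∧ IsSubbundle 2 U} from ⟨hLU, hU⟩)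
    exact ⟨h.1, le_inf h.2 hUW, hUQ⟩
  · rintro U₁ ⟨-, hLU₁, hU₁, -⟩ U₂ ⟨-, hLU₂, hU₂, -⟩ h
    exact hinj ⟨hLU₁, hU₁⟩ ⟨hLU₂, hU₂⟩ h
  · rintro M ⟨hM, hME, hMQ⟩
    obtain ⟨U, ⟨hLU, hU⟩, rfl⟩ := hsurj ⟨hM, hME.trans inf_le_left⟩
    exact ⟨U, ⟨hL, hLU, hU, hME.trans inf_le_right, hMQ⟩, rfl⟩

lemma isRelativeQuadric_of (hV : Module.finrank ℂ V = 5)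
    {B : (R : Type) → [CommRing R] → [Algebra ℂ R] → Set (Submodule R (R ⊗[ℂ] V))} {m : ℕ}
    (hB : ∀ (R : Type) [CommRing R] [Algebra ℂ R], ∀ L ∈ B R, IsSubbundle 1 L)
    (hs : ∀ (R : Type) [CommRing R] [Algebra ℂ R] [Algebra.FiniteType ℂ R], ∀ L ∈ B R,
      ∃ P, LinearMap.IsProj (wedgeSub R L ⊤ ⊔ W.baseChange R)
        (P : R ⊗[ℂ] ⋀[ℂ]^2 V →ₗ[R] R ⊗[ℂ] ⋀[ℂ]^2 V))
    (hr : ∀ (R : Type) [CommRing R] [Algebra ℂ R], ∀ L ∈ B R,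
      ∀ (x : R →ₐ[ℂ] ℂ) (v : V) (hv : v ≠ 0),
      pullback x L = closedPoint (Projectivization.mk ℂ v hv) →
      (m + 1) + Module.finrank ℂ ↥(LinearMap.range (wedgeVec V v) ⊔ W) =
        4 + Module.finrank ℂ W) :
    IsRelativeQuadric B (PUPoints W Q) m (wedgeBundle W) Q (fun R _ _ U => wedgeSub R U U) where
  isSubbundle R _ _ _ L hL := isSubbundle_wedgeBundle hV (hB R L hL) (hs R L hL) (hr R L hL)
  isSubbundle_pullback R _ _ _ _ _ _ _ f L hL := wedgeBundle_pullback (hB R L hL) (hs R L hL) f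
  bijOn R _ _ _ L hL := bijOn_PUPoints (hB R L hL)
  bijOn_pullback _ _ _ _ _ _ _ _ f _ _ U _ := pullback_wedgeSub f U U

end RelativeQuadric

/-! ### Exterior algebra: Koszul exactness and duality -/

section Koszul

variable {V : Type u} [AddCommGroup V] [Module ℂ V]

/-- The contraction of the exterior algebra with a linear form. -/
abbrev contractExt (f : Module.Dual ℂ V) : ExteriorAlgebra ℂ V →ₗ[ℂ] ExteriorAlgebra ℂ V :=
  CliffordAlgebra.contractLeft (Q := (0 : QuadraticForm ℂ V)) f

lemma contractExt_ι_mul (f : Module.Dual ℂ V) (v : V) (x : ExteriorAlgebra ℂ V) :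
    contractExt f (ExteriorAlgebra.ι ℂ v * x) =
      f v • x - ExteriorAlgebra.ι ℂ v * contractExt f x :=
  CliffordAlgebra.contractLeft_ι_mul f v x

/-- The Koszul complex of a nonzero vector is exact. -/
lemma eq_ι_mul_contractExt {f : Module.Dual ℂ V} {v : V} (hf : f v = 1) {x : ExteriorAlgebra ℂ V}
    (hx : ExteriorAlgebra.ι ℂ v * x = 0) : x = ExteriorAlgebra.ι ℂ v * contractExt f x := by
  have := contractExt_ι_mul f v x
  rwa [hx, map_zero, hf, one_smul, eq_comm, sub_eq_zero] at this

lemma ι_mul_mem {k : ℕ} (v : V) {x : ExteriorAlgebra ℂ V} (hx : x ∈ ⋀[ℂ]^k V) :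
    ExteriorAlgebra.ι ℂ v * x ∈ ⋀[ℂ]^(k + 1) V := by
  rw [ExteriorAlgebra.exteriorPower, pow_succ']
  exact Submodule.mul_mem_mul (LinearMap.mem_range_self _ v) hx

lemma exteriorPower_induction {k : ℕ} {p : ExteriorAlgebra ℂ V → Prop}
    (mul : ∀ (v : V), ∀ x ∈ ⋀[ℂ]^k V, p (ExteriorAlgebra.ι ℂ v * x))
    (add : ∀ x y, p x → p y → p (x + y)) {x : ExteriorAlgebra ℂ V} (hx : x ∈ ⋀[ℂ]^(k + 1) V) :
    p x := by
  rw [ExteriorAlgebra.exteriorPower, pow_succ'] at hx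
  refine Submodule.mul_induction_on hx ?_ add
  rintro _ ⟨v, rfl⟩ y hy
  exact mul v y hy

lemma contractExt_mem (f : Module.Dual ℂ V) {k : ℕ} :
    ∀ {x : ExteriorAlgebra ℂ V}, x ∈ ⋀[ℂ]^(k + 1) V → contractExt f x ∈ ⋀[ℂ]^k V := by
  induction k with
  | zero =>
    intro x hx
    refine exteriorPower_induction (p := fun x => contractExt f x ∈ ⋀[ℂ]^0 V) (fun v y hy => ?_)
      (fun x y hx hy => by rw [map_add]; exact add_mem hx hy) hx
    rw [ExteriorAlgebra.exteriorPower, pow_zero] at hy ⊢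
    obtain ⟨c, rfl⟩ := Submodule.mem_one.1 hy
    rw [contractExt_ι_mul, CliffordAlgebra.contractLeft_algebraMap, mul_zero, sub_zero]
    exact Submodule.smul_mem _ _ (Submodule.mem_one.2 ⟨c, rfl⟩)
  | succ k ih =>
    intro x hx
    refine exteriorPower_induction (p := fun x => contractExt f x ∈ ⋀[ℂ]^(k + 1) V)
      (fun v y hy => ?_) (fun x y hx hy => by rw [map_add]; exact add_mem hx hy) hx
    rw [contractExt_ι_mul]
    exact sub_mem (Submodule.smul_mem _ _ hy) (ι_mul_mem v (ih hy))

/-- Euler's formula: `∑ e_i ∧ (e_i^* ⌟ x) = k x` for `x ∈ ⋀^k V`. -/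
lemma sum_ι_mul_contractExt {ι : Type*} [Fintype ι] (b : Module.Basis ι ℂ V) {k : ℕ} :
    ∀ {x : ExteriorAlgebra ℂ V}, x ∈ ⋀[ℂ]^k V →
      ∑ i, ExteriorAlgebra.ι ℂ (b i) * contractExt (b.coord i) x = (k : ℂ) • x := by
  induction k with
  | zero =>
    intro x hx
    rw [ExteriorAlgebra.exteriorPower, pow_zero] at hx
    obtain ⟨c, rfl⟩ := Submodule.mem_one.1 hx
    simp [CliffordAlgebra.contractLeft_algebraMap]
  | succ k ih =>
    intro x hx
    refine exteriorPower_induction (p := fun x => ∑ i, ExteriorAlgebra.ι ℂ (b i) *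
      contractExt (b.coord i) x = ((k + 1 : ℕ) : ℂ) • x) (fun v y hy => ?_)
      (fun x y hx hy => by simp only [map_add, mul_add, Finset.sum_add_distrib, hx, hy,
        smul_add]) hx
    have hswap : ∀ i, ExteriorAlgebra.ι ℂ (b i) * (ExteriorAlgebra.ι ℂ v *
        contractExt (b.coord i) y) = -(ExteriorAlgebra.ι ℂ v *
          (ExteriorAlgebra.ι ℂ (b i) * contractExt (b.coord i) y)) := fun i => by
      rw [← mul_assoc, ← mul_assoc, ← neg_mul]
      congr 1
      exact eq_neg_of_add_eq_zero_left (ExteriorAlgebra.ι_add_mul_swap _ _)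
    simp_rw [contractExt_ι_mul, mul_sub, hswap, sub_neg_eq_add, Finset.sum_add_distrib,
      ← Finset.mul_sum, ih hy]
    have : ∑ i, ExteriorAlgebra.ι ℂ (b i) * (b.coord i v) • y = ExteriorAlgebra.ι ℂ v * y := by
      simp_rw [mul_smul_comm, ← smul_mul_assoc, ← Finset.sum_mul, ← map_smul, ← map_sum]
      congr 2
      exact b.sum_repr v
    rw [this, mul_smul_comm]
    push_cast
    rw [add_smul, one_smul, add_comm]

/-- A multivector of degree less than `dim V` that is killed by all vectors vanishes. -/
lemma eq_zero_of_forall_ι_mul_eq_zero [Module.Finite ℂ V] {k : ℕ} (hk : k ≠ Module.finrank ℂ V)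
    {x : ExteriorAlgebra ℂ V} (hx : x ∈ ⋀[ℂ]^k V)
    (h : ∀ v, ExteriorAlgebra.ι ℂ v * x = 0) : x = 0 := by
  let b := Module.finBasis ℂ V
  have h1 := sum_ι_mul_contractExt b hx
  have h2 : ∀ i, ExteriorAlgebra.ι ℂ (b i) * contractExt (b.coord i) x = x := fun i =>
    (eq_ι_mul_contractExt (by simp) (h (b i))).symm
  simp_rw [h2, Finset.sum_const, Finset.card_univ, Fintype.card_fin] at h1
  rw [← Nat.cast_smul_eq_nsmul ℂ, ← sub_eq_zero, ← sub_smul] at h1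
  refine (smul_eq_zero.1 h1).resolve_left (sub_ne_zero.2 ?_)
  exact_mod_cast hk.symm

lemma mul_ι_eq_zero_iff {k : ℕ} {x : ExteriorAlgebra ℂ V} (hx : x ∈ ⋀[ℂ]^k V) (v : V) :
    x * ExteriorAlgebra.ι ℂ v = 0 ↔ ExteriorAlgebra.ι ℂ v * x = 0 := by
  have key : ∀ (k : ℕ) (x : ExteriorAlgebra ℂ V), x ∈ ⋀[ℂ]^k V →
      x * ExteriorAlgebra.ι ℂ v = (-1 : ℂ) ^ k • (ExteriorAlgebra.ι ℂ v * x) := by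
    intro k
    induction k with
    | zero =>
      intro x hx
      rw [ExteriorAlgebra.exteriorPower, pow_zero] at hx
      obtain ⟨c, rfl⟩ := Submodule.mem_one.1 hx
      simp [Algebra.commutes]
    | succ k ih =>
      intro x hx
      refine exteriorPower_induction (p := fun x => x * ExteriorAlgebra.ι ℂ v =
        (-1 : ℂ) ^ (k + 1) • (ExteriorAlgebra.ι ℂ v * x)) (fun u y hy => ?_)
        (fun x y hx hy => by rw [add_mul, hx, hy, mul_add, smul_add]) hx
      have hs : ExteriorAlgebra.ι ℂ u * ExteriorAlgebra.ι ℂ v =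
          -(ExteriorAlgebra.ι ℂ v * ExteriorAlgebra.ι ℂ u) :=
        eq_neg_of_add_eq_zero_left (ExteriorAlgebra.ι_add_mul_swap _ _)
      rw [mul_assoc, ih y hy, mul_smul_comm, ← mul_assoc, hs, neg_mul, smul_neg, pow_succ,
        mul_neg_one, neg_smul, mul_assoc]
  rw [key k x hx, smul_eq_zero_iff_right (pow_ne_zero _ (by norm_num))]

end Koszul

section Pairing

variable {V : Type u} [AddCommGroup V] [Module ℂ V]

/-- The pairing `⋀³ V × ⋀² V → ⋀⁵ V ≃ ℂ`. -/
def volPairing (vol : ⋀[ℂ]^5 V ≃ₗ[ℂ] ℂ) : ⋀[ℂ]^3 V →ₗ[ℂ] Module.Dual ℂ (⋀[ℂ]^2 V) :=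
  (wedge V 3 2).compr₂ vol.toLinearMap

lemma volPairing_apply (vol : ⋀[ℂ]^5 V ≃ₗ[ℂ] ℂ) (ξ : ⋀[ℂ]^3 V) (w : ⋀[ℂ]^2 V) :
    volPairing vol ξ w = vol (wedge V 3 2 ξ w) := rfl

lemma volPairing_eq_zero_iff (vol : ⋀[ℂ]^5 V ≃ₗ[ℂ] ℂ) (ξ : ⋀[ℂ]^3 V) (w : ⋀[ℂ]^2 V) :
    volPairing vol ξ w = 0 ↔ (ξ : ExteriorAlgebra ℂ V) * w = 0 := by
  rw [volPairing_apply, LinearEquiv.map_eq_zero_iff]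
  exact Subtype.ext_iff

/-- For `ξ ∈ ⋀³ V`, the form `ξ ∧ -` vanishes on `v ∧ V` if and only if `v ∧ ξ = 0`. -/
lemma range_wedgeVec_le_ker_volPairing (hV : Module.finrank ℂ V = 5) (vol : ⋀[ℂ]^5 V ≃ₗ[ℂ] ℂ)
    (ξ : ⋀[ℂ]^3 V) (v : V) : LinearMap.range (wedgeVec V v) ≤ LinearMap.ker (volPairing vol ξ) ↔
      ExteriorAlgebra.ι ℂ v * (ξ : ExteriorAlgebra ℂ V) = 0 := by
  have : Module.Finite ℂ V := Module.finite_of_finrank_pos (by omega)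
  have h1 : LinearMap.range (wedgeVec V v) ≤ LinearMap.ker (volPairing vol ξ) ↔
      ∀ u, (ξ : ExteriorAlgebra ℂ V) * (ExteriorAlgebra.ι ℂ v * ExteriorAlgebra.ι ℂ u) = 0 := by
    refine ⟨fun h u => ?_, ?_⟩
    · exact (volPairing_eq_zero_iff vol ξ _).1 (h ⟨u, rfl⟩)
    · rintro h _ ⟨u, rfl⟩
      exact (volPairing_eq_zero_iff vol ξ _).2 (h u)
  rw [h1, ← mul_ι_eq_zero_iff ξ.2]
  refine ⟨fun h => ?_, fun h u => by rw [← mul_assoc, h, zero_mul]⟩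
  have hmem : (ξ : ExteriorAlgebra ℂ V) * ExteriorAlgebra.ι ℂ v ∈ ⋀[ℂ]^4 V := by
    rw [ExteriorAlgebra.exteriorPower, pow_succ]
    exact Submodule.mul_mem_mul ξ.2 (LinearMap.mem_range_self _ v)
  refine eq_zero_of_forall_ι_mul_eq_zero (by omega) hmem fun u => ?_
  rw [← mul_ι_eq_zero_iff hmem, mul_assoc]
  exact h u

/-- The pairing `⋀³ V × ⋀² V → ℂ` is perfect. -/
lemma volPairing_bijective (hV : Module.finrank ℂ V = 5) (vol : ⋀[ℂ]^5 V ≃ₗ[ℂ] ℂ) :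
    Function.Bijective (volPairing vol) := by
  have : Module.Finite ℂ V := Module.finite_of_finrank_pos (by omega)
  have hinj : Function.Injective (volPairing vol) := by
    refine (injective_iff_map_eq_zero _).2 fun ξ hξ => Subtype.ext ?_
    refine eq_zero_of_forall_ι_mul_eq_zero (by omega) ξ.2 fun v => ?_
    exact (range_wedgeVec_le_ker_volPairing hV vol ξ v).1
      (by rw [hξ, LinearMap.ker_zero]; exact le_top)
  refine ⟨hinj, (LinearMap.injective_iff_surjective_of_finrank_eq_finrank ?_).1 hinj⟩
  rw [Subspace.dual_finrank_eq, exteriorPower.finrank_eq, exteriorPower.finrank_eq, hV]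
  rfl

end Pairing

section Lagrangian

variable {V : Type u} [AddCommGroup V] [Module ℂ V]

/-- The map `(x, y) ↦ x + v₀ ∧ y` from `⋀ V × ⋀ V` to `⋀ (V ⊕ ℂ v₀)`. -/
def sumV₀ (V : Type u) [AddCommGroup V] [Module ℂ V] :
    ExteriorAlgebra ℂ V × ExteriorAlgebra ℂ V →ₗ[ℂ] ExteriorAlgebra ℂ (V × ℂ) :=
  (ExteriorAlgebra.map (LinearMap.inl ℂ V ℂ)).toLinearMap.coprod
    (LinearMap.mulLeft ℂ (ExteriorAlgebra.ι ℂ ((0, 1) : V × ℂ)) ∘ₗ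
      (ExteriorAlgebra.map (LinearMap.inl ℂ V ℂ)).toLinearMap)

lemma sumV₀_apply (x y : ExteriorAlgebra ℂ V) : sumV₀ V (x, y) =
    ExteriorAlgebra.map (LinearMap.inl ℂ V ℂ) x +
      ExteriorAlgebra.ι ℂ ((0, 1) : V × ℂ) * ExteriorAlgebra.map (LinearMap.inl ℂ V ℂ) y := rfl

lemma contractExt_map_inl (x : ExteriorAlgebra ℂ V) :
    contractExt (LinearMap.snd ℂ V ℂ) (ExteriorAlgebra.map (LinearMap.inl ℂ V ℂ) x) = 0 := by
  induction x using CliffordAlgebra.left_induction with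
  | algebraMap r =>
    rw [AlgHom.commutes]
    exact CliffordAlgebra.contractLeft_algebraMap (Q := (0 : QuadraticForm ℂ (V × ℂ)))
      (LinearMap.snd ℂ V ℂ) r
  | add x y hx hy => rw [map_add, map_add, hx, hy, add_zero]
  | ι_mul x v hx =>
    have : ExteriorAlgebra.map (LinearMap.inl ℂ V ℂ) (CliffordAlgebra.ι 0 v * x) =
        ExteriorAlgebra.ι ℂ (v, (0 : ℂ)) * ExteriorAlgebra.map (LinearMap.inl ℂ V ℂ) x := by
      rw [map_mul]
      congr 1
      exact ExteriorAlgebra.map_apply_ι (LinearMap.inl ℂ V ℂ) v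
    rw [this, contractExt_ι_mul, hx]
    simp

lemma sumV₀_injective : Function.Injective (sumV₀ V) := by
  have hleft : ∀ x, ExteriorAlgebra.map (LinearMap.fst ℂ V ℂ)
      (ExteriorAlgebra.map (LinearMap.inl ℂ V ℂ) x) = x := fun x => by
    rw [← AlgHom.comp_apply, ExteriorAlgebra.map_comp_map, LinearMap.fst_comp_inl,
      ExteriorAlgebra.map_id, AlgHom.id_apply]
  refine (injective_iff_map_eq_zero _).2 ?_
  rintro ⟨x, y⟩ h
  rw [sumV₀_apply] at h
  have hx : x = 0 := by
    have := congrArg (ExteriorAlgebra.map (LinearMap.fst ℂ V ℂ)) h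
    rw [map_add, map_mul, hleft, hleft, ExteriorAlgebra.map_apply_ι] at this
    simpa using this
  rw [hx, map_zero, zero_add] at h
  have := congrArg (contractExt (LinearMap.snd ℂ V ℂ)) h
  rw [contractExt_ι_mul, contractExt_map_inl] at this
  have hy : ExteriorAlgebra.map (LinearMap.inl ℂ V ℂ) y = 0 := by simpa using this
  have hy' := hleft y
  rw [hy, map_zero] at hy'
  rw [hx, ← hy', Prod.mk_zero_zero]

lemma ι_inl_mul_sumV₀ (v : V) (x y : ExteriorAlgebra ℂ V) :
    ExteriorAlgebra.ι ℂ (v, (0 : ℂ)) * sumV₀ V (x, y) =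
      sumV₀ V (ExteriorAlgebra.ι ℂ v * x, -(ExteriorAlgebra.ι ℂ v * y)) := by
  have hv : ExteriorAlgebra.ι ℂ (v, (0 : ℂ)) =
      ExteriorAlgebra.map (LinearMap.inl ℂ V ℂ) (ExteriorAlgebra.ι ℂ v) :=
    (ExteriorAlgebra.map_apply_ι (LinearMap.inl ℂ V ℂ) v).symm
  have hs : ExteriorAlgebra.ι ℂ (v, (0 : ℂ)) * ExteriorAlgebra.ι ℂ ((0, 1) : V × ℂ) =
      -(ExteriorAlgebra.ι ℂ ((0, 1) : V × ℂ) * ExteriorAlgebra.ι ℂ (v, (0 : ℂ))) :=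
    eq_neg_of_add_eq_zero_left (ExteriorAlgebra.ι_add_mul_swap _ _)
  rw [sumV₀_apply, sumV₀_apply, mul_add, ← mul_assoc, hs, map_neg, map_mul, map_mul, ← hv, mul_neg,
    neg_mul, mul_assoc]

lemma map_inl_mem {k : ℕ} : ∀ {x : ExteriorAlgebra ℂ V}, x ∈ ⋀[ℂ]^k V →
    ExteriorAlgebra.map (LinearMap.inl ℂ V ℂ) x ∈ ⋀[ℂ]^k (V × ℂ) := by
  induction k with
  | zero =>
    intro x hx
    rw [ExteriorAlgebra.exteriorPower, pow_zero] at hx ⊢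
    obtain ⟨c, rfl⟩ := Submodule.mem_one.1 hx
    rw [AlgHom.commutes]
    exact Submodule.mem_one.2 ⟨c, rfl⟩
  | succ k ih =>
    intro x hx
    refine exteriorPower_induction (p := fun x => ExteriorAlgebra.map (LinearMap.inl ℂ V ℂ) x ∈
      ⋀[ℂ]^(k + 1) (V × ℂ)) (fun v y hy => ?_)
      (fun x y hx hy => by rw [map_add]; exact add_mem hx hy) hx
    rw [map_mul, ExteriorAlgebra.map_apply_ι]
    exact ι_mul_mem _ (ih hy)

/-- An element `ξ + v₀ ∧ w` of `⋀³ V₆` lies in `v ∧ ⋀² V₆` if and only if `v ∧ ξ = v ∧ w = 0`. -/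
lemma sumV₀_mem_iff {v : V} (hv : v ≠ 0) {ξ w : ExteriorAlgebra ℂ V} (hξ : ξ ∈ ⋀[ℂ]^3 V)
    (hw : w ∈ ⋀[ℂ]^2 V) :
    sumV₀ V (ξ, w) ∈ (ℂ ∙ (v, (0 : ℂ))).map (ExteriorAlgebra.ι ℂ) * ⋀[ℂ]^2 (V × ℂ) ↔
      ExteriorAlgebra.ι ℂ v * ξ = 0 ∧ ExteriorAlgebra.ι ℂ v * w = 0 := by
  rw [Submodule.map_span, Set.image_singleton]
  constructor
  · intro h
    have h0 : ExteriorAlgebra.ι ℂ (v, (0 : ℂ)) * sumV₀ V (ξ, w) = 0 := by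
      obtain ⟨z, -, hz⟩ := Submodule.mem_span_singleton_mul.1 h
      rw [← hz, ← mul_assoc, ExteriorAlgebra.ι_sq_zero, zero_mul]
    rw [ι_inl_mul_sumV₀] at h0
    have := Prod.ext_iff.1 (sumV₀_injective (h0.trans (map_zero _).symm))
    exact ⟨this.1, neg_eq_zero.1 this.2⟩
  · rintro ⟨h1, h2⟩
    obtain ⟨f, hf⟩ := exists_dual_eq_one hv
    refine Submodule.mem_span_singleton_mul.2
      ⟨sumV₀ V (contractExt f ξ, -contractExt f w), ?_, ?_⟩
    · rw [sumV₀_apply]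
      exact add_mem (map_inl_mem (contractExt_mem f hξ))
        (ι_mul_mem _ (map_inl_mem (neg_mem (contractExt_mem f hw))))
    · rw [ι_inl_mul_sumV₀, ← eq_ι_mul_contractExt hf h1, mul_neg, neg_neg,
        ← eq_ι_mul_contractExt hf h2]

end Lagrangian

/-! ### The Lagrangian and the corank of the fibers -/

section Corank

variable {V : Type u} [AddCommGroup V] [Module ℂ V]

/-- The pairs `(ξ, w)` such that `ξ + v₀ ∧ w` lies in `A ∩ (v ∧ ⋀² V₆)`. -/
def lagrangianPairsAt (W : Submodule ℂ (⋀[ℂ]^2 V)) (Q : QuadraticForm ℂ (⋀[ℂ]^2 V))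
    (vol : ⋀[ℂ]^5 V ≃ₗ[ℂ] ℂ) (v : V) : Submodule ℂ (⋀[ℂ]^3 V × ⋀[ℂ]^2 V) :=
  lagrangianPairs W Q vol ⊓
    (LinearMap.ker (LinearMap.mulLeft ℂ (ExteriorAlgebra.ι ℂ v) ∘ₗ (⋀[ℂ]^3 V).subtype)).prod
      (LinearMap.ker (LinearMap.mulLeft ℂ (ExteriorAlgebra.ι ℂ v) ∘ₗ (⋀[ℂ]^2 V).subtype))

lemma mem_lagrangianPairsAt {W : Submodule ℂ (⋀[ℂ]^2 V)} {Q : QuadraticForm ℂ (⋀[ℂ]^2 V)}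
    {vol : ⋀[ℂ]^5 V ≃ₗ[ℂ] ℂ} {v : V} {ξ : ⋀[ℂ]^3 V} {w : ⋀[ℂ]^2 V} :
    (ξ, w) ∈ lagrangianPairsAt W Q vol v ↔
      (w ∈ W ∧ ∀ w' ∈ W, volPairing vol ξ w' + QuadraticMap.associated (R := ℂ) Q w w' = 0) ∧
      ExteriorAlgebra.ι ℂ v * (ξ : ExteriorAlgebra ℂ V) = 0 ∧
      ExteriorAlgebra.ι ℂ v * (w : ExteriorAlgebra ℂ V) = 0 := Iff.rfl

lemma finrank_lagrangian_inf (W : Submodule ℂ (⋀[ℂ]^2 V)) (Q : QuadraticForm ℂ (⋀[ℂ]^2 V))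
    (vol : ⋀[ℂ]^5 V ≃ₗ[ℂ] ℂ) {v : V} (hv : v ≠ 0) :
    Module.finrank ℂ ↥(lagrangian W Q vol ⊓
      ((ℂ ∙ (v, (0 : ℂ))).map (ExteriorAlgebra.ι ℂ) * ⋀[ℂ]^2 (V × ℂ))) =
      Module.finrank ℂ (lagrangianPairsAt W Q vol v) := by
  let j : ⋀[ℂ]^3 V × ⋀[ℂ]^2 V →ₗ[ℂ] ExteriorAlgebra ℂ (V × ℂ) :=
    sumV₀ V ∘ₗ (⋀[ℂ]^3 V).subtype.prodMap (⋀[ℂ]^2 V).subtype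
  have hj : Function.Injective j := sumV₀_injective.comp
    (Function.Injective.prodMap Subtype.val_injective Subtype.val_injective)
  have hA : lagrangian W Q vol = (lagrangianPairs W Q vol).map j := by
    rw [lagrangian]
    congr 1
  have hmap : lagrangian W Q vol ⊓
      ((ℂ ∙ (v, (0 : ℂ))).map (ExteriorAlgebra.ι ℂ) * ⋀[ℂ]^2 (V × ℂ)) =
      (lagrangianPairsAt W Q vol v).map j := by
    rw [hA]
    ext z
    constructor
    · rintro ⟨⟨⟨ξ, w⟩, hx, rfl⟩, hz⟩
      exact ⟨(ξ, w), ⟨hx, (sumV₀_mem_iff hv ξ.2 w.2).1 hz⟩, rfl⟩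
    · rintro ⟨⟨ξ, w⟩, ⟨hx, hx'⟩, rfl⟩
      exact ⟨⟨(ξ, w), hx, rfl⟩, (sumV₀_mem_iff hv ξ.2 w.2).2 hx'⟩
  rw [hmap]
  exact (Submodule.equivMapOfInjective j hj _).finrank_eq.symm

lemma ι_mul_eq_zero_iff_mem_range {v : V} (hv : v ≠ 0) (w : ⋀[ℂ]^2 V) :
    ExteriorAlgebra.ι ℂ v * (w : ExteriorAlgebra ℂ V) = 0 ↔
      w ∈ LinearMap.range (wedgeVec V v) := by
  constructor
  · intro h
    obtain ⟨f, hf⟩ := exists_dual_eq_one hv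
    have h1 := contractExt_mem f (k := 1) w.2
    rw [ExteriorAlgebra.exteriorPower, pow_one] at h1
    obtain ⟨u, hu⟩ := h1
    exact ⟨u, Subtype.ext (by rw [wedgeVec_coe, hu, ← eq_ι_mul_contractExt hf h])⟩
  · rintro ⟨u, rfl⟩
    rw [wedgeVec_coe, ← mul_assoc, ExteriorAlgebra.ι_sq_zero, zero_mul]

lemma mem_radical_iff {M : Type*} [AddCommGroup M] [Module ℂ M] {q : QuadraticForm ℂ M}
    {N : Submodule ℂ M} {w : M} : w ∈ N ⊓ N.orthogonalBilin q.polarBilin ↔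
      w ∈ N ∧ ∀ w' ∈ N, QuadraticMap.associated (R := ℂ) q w w' = 0 := by
  have h2 : ∀ x y, QuadraticMap.polarBilin q x y = 2 * QuadraticMap.associated (R := ℂ) q y x := by
    intro x y
    have := LinearMap.congr_fun₂ (QuadraticMap.two_nsmul_associated ℂ q) y x
    rw [QuadraticMap.polarBilin_apply_apply, QuadraticMap.polar_comm,
      ← QuadraticMap.polarBilin_apply_apply, ← this, LinearMap.smul_apply, LinearMap.smul_apply,
      two_nsmul, two_mul]
  refine and_congr_right fun _ => forall₂_congr fun x _ => ?_
  change QuadraticMap.polarBilin q x w = 0 ↔ _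
  rw [h2]
  simp

/-- The projection `(ξ, w) ↦ w` maps `A ∩ (v ∧ ⋀² V₆)` onto the radical of the restriction of `Q`
to `E_v`. -/
lemma map_snd_lagrangianPairsAt (hV : Module.finrank ℂ V = 5) (W : Submodule ℂ (⋀[ℂ]^2 V))
    (Q : QuadraticForm ℂ (⋀[ℂ]^2 V)) (vol : ⋀[ℂ]^5 V ≃ₗ[ℂ] ℂ) {v : V} (hv : v ≠ 0) :
    (lagrangianPairsAt W Q vol v).map (LinearMap.snd ℂ _ _) =
      (LinearMap.range (wedgeVec V v) ⊓ W) ⊓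
        (LinearMap.range (wedgeVec V v) ⊓ W).orthogonalBilin Q.polarBilin := by
  have : Module.Finite ℂ V := Module.finite_of_finrank_pos (by omega)
  ext w
  rw [mem_radical_iff]
  constructor
  · rintro ⟨⟨ξ, w⟩, h, rfl⟩
    obtain ⟨⟨hwW, h⟩, hξ, hw⟩ := mem_lagrangianPairsAt.1 h
    refine ⟨⟨(ι_mul_eq_zero_iff_mem_range hv w).1 hw, hwW⟩, fun w' hw' => ?_⟩
    have h1 := h w' hw'.2
    have h2 : volPairing vol ξ w' = 0 :=
      (range_wedgeVec_le_ker_volPairing hV vol ξ v).2 hξ hw'.1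
    rwa [h2, zero_add] at h1
  · rintro ⟨⟨hwv, hwW⟩, h⟩
    -- `Q(w, -)` vanishes on the intersection, so it is a sum of forms vanishing on each subspace.
    have ha : QuadraticMap.associated (R := ℂ) Q w ∈
        (LinearMap.range (wedgeVec V v) ⊓ W).dualAnnihilator :=
      (Submodule.mem_dualAnnihilator _).2 h
    rw [Subspace.dualAnnihilator_inf_eq] at ha
    obtain ⟨α, hα, β, hβ, hαβ⟩ := Submodule.mem_sup.1 ha
    obtain ⟨ξ, hξ⟩ := (volPairing_bijective hV vol).2 (-α)
    refine ⟨(ξ, w), mem_lagrangianPairsAt.2 ⟨⟨hwW, fun w' hw' => ?_⟩, ?_,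
      (ι_mul_eq_zero_iff_mem_range hv w).2 hwv⟩, rfl⟩
    · have := (Submodule.mem_dualAnnihilator _).1 hβ w' hw'
      rw [hξ, ← hαβ, LinearMap.add_apply, this]
      simp
    · rw [← range_wedgeVec_le_ker_volPairing hV vol, hξ]
      intro x hx
      simpa using (Submodule.mem_dualAnnihilator _).1 hα x hx

/-- The pairs `(ξ, 0)` in `A ∩ (v ∧ ⋀² V₆)` are given by the forms vanishing on `v ∧ V` and `W`. -/
lemma lagrangianPairsAt_inf_ker_snd (hV : Module.finrank ℂ V = 5) (W : Submodule ℂ (⋀[ℂ]^2 V))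
    (Q : QuadraticForm ℂ (⋀[ℂ]^2 V)) (vol : ⋀[ℂ]^5 V ≃ₗ[ℂ] ℂ) (v : V) :
    lagrangianPairsAt W Q vol v ⊓ LinearMap.ker (LinearMap.snd ℂ _ _) =
      (((LinearMap.range (wedgeVec V v) ⊔ W).dualAnnihilator).comap (volPairing vol)).map
        (LinearMap.inl ℂ _ _) := by
  have hmem : ∀ ξ, ξ ∈ ((LinearMap.range (wedgeVec V v) ⊔ W).dualAnnihilator).comap
      (volPairing vol) ↔ ExteriorAlgebra.ι ℂ v * (ξ : ExteriorAlgebra ℂ V) = 0 ∧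
        ∀ w ∈ W, volPairing vol ξ w = 0 := by
    intro ξ
    rw [Submodule.mem_comap, Submodule.dualAnnihilator_sup_eq, Submodule.mem_inf,
      Submodule.mem_dualAnnihilator, Submodule.mem_dualAnnihilator,
      ← range_wedgeVec_le_ker_volPairing hV vol]
    rfl
  ext ⟨ξ, w⟩
  constructor
  · rintro ⟨h, h0⟩
    obtain rfl : w = 0 := h0
    obtain ⟨⟨-, h⟩, hξ, -⟩ := mem_lagrangianPairsAt.1 h
    exact ⟨ξ, (hmem ξ).2 ⟨hξ, fun w' hw' => by simpa using h w' hw'⟩, rfl⟩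
  · rintro ⟨ξ', h, h'⟩
    obtain ⟨rfl, rfl⟩ := Prod.ext_iff.1 h'
    obtain ⟨hξ, h⟩ := (hmem ξ').1 h
    exact ⟨mem_lagrangianPairsAt.2 ⟨⟨W.zero_mem, fun w' hw' => by simpa using h w' hw'⟩, hξ,
      by simp⟩, rfl⟩

lemma finrank_map_add_finrank_inf_ker {M N : Type*} [AddCommGroup M] [Module ℂ M]
    [Module.Finite ℂ M] [AddCommGroup N] [Module ℂ N] (f : M →ₗ[ℂ] N) (S : Submodule ℂ M) :
    Module.finrank ℂ (S.map f) + Module.finrank ℂ ↥(S ⊓ LinearMap.ker f) =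
      Module.finrank ℂ S := by
  rw [← LinearMap.finrank_range_add_finrank_ker (f.domRestrict S), LinearMap.range_domRestrict,
    LinearMap.ker_domRestrict, ← Submodule.map_comap_subtype,
    (Submodule.equivMapOfInjective S.subtype Subtype.val_injective
      ((LinearMap.ker f).comap S.subtype)).finrank_eq]

/-- The dimension of `A ∩ (v ∧ ⋀² V₆)` is the corank of `Q|_{E_v}` plus the codimension of
`(v ∧ V) + W`. -/
theorem finrank_lagrangian_inf_add (hV : Module.finrank ℂ V = 5) (W : Submodule ℂ (⋀[ℂ]^2 V))
    (Q : QuadraticForm ℂ (⋀[ℂ]^2 V)) (vol : ⋀[ℂ]^5 V ≃ₗ[ℂ] ℂ) {v : V} (hv : v ≠ 0) :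
    Module.finrank ℂ ↥(lagrangian W Q vol ⊓
      ((ℂ ∙ (v, (0 : ℂ))).map (ExteriorAlgebra.ι ℂ) * ⋀[ℂ]^2 (V × ℂ))) +
      Module.finrank ℂ ↥(LinearMap.range (wedgeVec V v) ⊔ W) =
      corank Q (LinearMap.range (wedgeVec V v) ⊓ W) + 10 := by
  have : Module.Finite ℂ V := Module.finite_of_finrank_pos (by omega)
  have h1 := finrank_map_add_finrank_inf_ker (LinearMap.snd ℂ (⋀[ℂ]^3 V) (⋀[ℂ]^2 V))
    (lagrangianPairsAt W Q vol v)
  have h2 : Module.finrank ℂ ↥(lagrangianPairsAt W Q vol v ⊓ LinearMap.ker (LinearMap.snd ℂ _ _)) =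
      Module.finrank ℂ (LinearMap.range (wedgeVec V v) ⊔ W).dualAnnihilator := by
    rw [lagrangianPairsAt_inf_ker_snd hV]
    rw [← (Submodule.equivMapOfInjective (LinearMap.inl ℂ (⋀[ℂ]^3 V) (⋀[ℂ]^2 V))
      LinearMap.inl_injective _).finrank_eq]
    let e' := LinearEquiv.ofBijective (volPairing vol) (volPairing_bijective hV vol)
    have : ((LinearMap.range (wedgeVec V v) ⊔ W).dualAnnihilator).comap (volPairing vol) =
        ((LinearMap.range (wedgeVec V v) ⊔ W).dualAnnihilator).map e'.symm.toLinearMap :=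
      (Submodule.map_equiv_eq_comap_symm e'.symm _).symm
    rw [this]
    exact LinearEquiv.finrank_map_eq e'.symm _
  have h3 := Subspace.finrank_add_finrank_dualAnnihilator_eq (LinearMap.range (wedgeVec V v) ⊔ W)
  rw [map_snd_lagrangianPairsAt hV W Q vol hv, h2] at h1
  rw [finrank_wedge_two hV] at h3
  rw [finrank_lagrangian_inf W Q vol hv, corank]
  omega

lemma corank_baseChange_self {T : Type u} [AddCommGroup T] [Module ℂ T] (q : QuadraticForm ℂ T)
    (N : Submodule ℂ T) : corank (q.baseChange ℂ) (N.baseChange ℂ) = corank q N := by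
  have hq : ∀ x : ℂ ⊗[ℂ] T, q.baseChange ℂ x = q (TensorProduct.lid ℂ T x) := by
    intro x
    have : x = (1 : ℂ) ⊗ₜ[ℂ] TensorProduct.lid ℂ T x := by
      rw [← TensorProduct.lid_symm_apply, LinearEquiv.symm_apply_apply]
    conv_lhs => rw [this, QuadraticForm.baseChange_tmul]
    simp
  have hpolar : ∀ x y : T, QuadraticMap.polar (q.baseChange ℂ) ((TensorProduct.lid ℂ T).symm x)
      ((TensorProduct.lid ℂ T).symm y) = QuadraticMap.polar q x y := fun x y => by
    simp only [QuadraticMap.polar, ← map_add, hq, LinearEquiv.apply_symm_apply]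
  rw [corank, corank, baseChange_self_eq_map]
  have : N.map (TensorProduct.lid ℂ T).symm.toLinearMap ⊓
      (N.map (TensorProduct.lid ℂ T).symm.toLinearMap).orthogonalBilin (q.baseChange ℂ).polarBilin =
      (N ⊓ N.orthogonalBilin q.polarBilin).map (TensorProduct.lid ℂ T).symm.toLinearMap := by
    ext x
    constructor
    · rintro ⟨⟨y, hy, rfl⟩, h⟩
      exact ⟨y, ⟨hy, fun z hz => (hpolar z y).symm.trans (h _ ⟨z, hz, rfl⟩)⟩, rfl⟩
    · rintro ⟨y, ⟨hy, h⟩, rfl⟩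
      refine ⟨⟨y, hy, rfl⟩, ?_⟩
      rintro _ ⟨z, hz, rfl⟩
      exact (hpolar z y).trans (h z hz)
  rw [this]
  exact LinearEquiv.finrank_map_eq _ _

end Corank

end GM

end

theorem proposition3p1 (n : ℕ) (hn : n = 3 ∨ n = 4 ∨ n = 5)
    {V₅ : Type*} [AddCommGroup V₅] [Module ℂ V₅] (hV₅ : Module.finrank ℂ V₅ = 5)
    (W : Submodule ℂ (⋀[ℂ]^2 V₅)) (hW : Module.finrank ℂ W = n + 5)
    (Q : QuadraticForm ℂ (⋀[ℂ]^2 V₅)) (hX : GM.IsSmoothOfDim n W Q)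
    (vol : ⋀[ℂ]^5 V₅ ≃ₗ[ℂ] ℂ) :
    (∀ p : ℙ ℂ V₅, ∃ x ∈ GM.PUPoints W Q ℂ, GM.rho x = GM.closedPoint p) ∧
    (GM.IsRelativeQuadric (GM.Sigma1Compl W) (GM.PUPoints W Q) (n - 2) (GM.wedgeBundle W) Q
        (fun R _ _ U => GM.wedgeSub R U U) ∧
      ∀ p : ℙ ℂ V₅, GM.closedPoint p ∉ GM.Sigma1 W ℂ → ∀ k : ℕ,
        (GM.corank (Q.baseChange ℂ) (GM.wedgeBundle W ℂ (GM.closedPoint p)) = k ↔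
          GM.hyperplaneIncl p ∈ GM.YEq (GM.lagrangian W Q vol) k)) ∧
    (GM.IsRelativeQuadric (GM.Sigma1 W) (GM.PUPoints W Q) (n - 1) (GM.wedgeBundle W) Q
        (fun R _ _ U => GM.wedgeSub R U U) ∧
      ∀ p : ℙ ℂ V₅, GM.closedPoint p ∈ GM.Sigma1 W ℂ → ∀ k : ℕ,
        (GM.corank (Q.baseChange ℂ) (GM.wedgeBundle W ℂ (GM.closedPoint p)) = k ↔
          GM.hyperplaneIncl p ∈ GM.YEq (GM.lagrangian W Q vol) (k + 1))) ∧
    (∀ p : ℙ ℂ V₅, GM.closedPoint p ∈ GM.Sigma1 W ℂ →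
      GM.hyperplaneIncl p ∈ GM.YGe (GM.lagrangian W Q vol) 1) := by
  open GM in
  have hfin : Module.Finite ℂ V₅ := Module.finite_of_finrank_pos (by omega)
  have hT := finrank_wedge_two hV₅
  have h9 : ∀ v : V₅, v ≠ 0 → 9 ≤ Module.finrank ℂ ↥(LinearMap.range (wedgeVec V₅ v) ⊔ W) :=
    fun v hv => finrank_wedge_sup_ge hV₅ hn hW hX hv
  have hoff : ∀ (v : V₅) (hv : v ≠ 0),
      closedPoint (Projectivization.mk ℂ v hv) ∉ Sigma1 W ℂ →
      Module.finrank ℂ ↥(LinearMap.range (wedgeVec V₅ v) ⊔ W) = 10 := fun v hv h => by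
    rw [closedPoint_mem_Sigma1, not_not] at h
    rw [h, finrank_top, hT]
  have hon : ∀ (v : V₅) (hv : v ≠ 0), closedPoint (Projectivization.mk ℂ v hv) ∈ Sigma1 W ℂ →
      Module.finrank ℂ ↥(LinearMap.range (wedgeVec V₅ v) ⊔ W) = 9 := fun v hv h => by
    have h1 := Submodule.finrank_lt ((closedPoint_mem_Sigma1 hv).1 h)
    have h2 := h9 v hv
    omega
  -- The common formula for the corank of the fibers of `ρ`.
  have hcorank : ∀ (v : V₅) (hv : v ≠ 0) (l : ℕ),
      hyperplaneIncl (Projectivization.mk ℂ v hv) ∈ YGe (lagrangian W Q vol) l ↔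
      l + Module.finrank ℂ ↥(LinearMap.range (wedgeVec V₅ v) ⊔ W) ≤
        corank (Q.baseChange ℂ) (wedgeBundle W ℂ (closedPoint (Projectivization.mk ℂ v hv))) +
          10 := by
    intro v hv l
    rw [wedgeBundle_closedPoint, corank_baseChange_self,
      ← finrank_lagrangian_inf_add hV₅ W Q vol hv, hyperplaneIncl, Projectivization.map_mk]
    change l ≤ Module.finrank ℂ _ ↔ _
    rw [Projectivization.submodule_mk, LinearMap.inl_apply]
    omega
  refine ⟨fun p => ?_, ⟨?_, fun p hp k => ?_⟩, ⟨?_, fun p hp k => ?_⟩, fun p hp => ?_⟩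
  · induction p using Projectivization.ind with | _ v hv =>
    have hdim := finrank_wedgeBundle_closedPoint (W := W) hV₅ hv
    have hle := Submodule.finrank_le (LinearMap.range (wedgeVec V₅ v) ⊔ W)
    obtain ⟨w, hw, hw0, hQ⟩ := exists_isotropic (Q.baseChange ℂ)
      (N := wedgeBundle W ℂ (closedPoint (Projectivization.mk ℂ v hv))) (by omega)
    obtain ⟨U, hU, -⟩ := (bijOn_PUPoints (W := W) (Q := Q)
      (isSubbundle_closedPoint (Projectivization.mk ℂ v hv))).2.2
      (show ℂ ∙ w ∈ _ from ⟨isSubbundle_iff_finrank.2 (finrank_span_singleton hw0),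
        (Submodule.span_singleton_le_iff_mem _ _).2 hw, fun x hx => by
          obtain ⟨c, rfl⟩ := Submodule.mem_span_singleton.1 hx
          rw [QuadraticMap.map_smul, hQ, smul_zero]⟩)
    exact ⟨_, hU, rfl⟩
  · refine isRelativeQuadric_of hV₅ (fun R _ _ L hL => hL.1) (fun R _ _ _ L hL =>
      ⟨LinearMap.id, by rw [wedgeSub_sup_eq_top hL]; exact LinearMap.IsProj.top R _⟩)
      fun R _ _ L hL x v hv hLv => ?_
    rw [hoff v hv (hLv ▸ hL.2 x)]
    omega
  · induction p using Projectivization.ind with | _ v hv =>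
    rw [YEq, Set.mem_sdiff, hcorank, hcorank, hoff v hv hp]
    omega
  · refine isRelativeQuadric_of hV₅ (fun R _ _ L hL => hL.1)
      (fun R _ _ _ L hL => exists_isProj_wedgeSub_sup hV₅ h9 hL) fun R _ _ L hL x v hv hLv => ?_
    rw [hon v hv (hLv ▸ Sigma1_pullback x hL)]
    omega
  · induction p using Projectivization.ind with | _ v hv =>
    rw [YEq, Set.mem_sdiff, hcorank, hcorank, hon v hv hp]
    omega
  · induction p using Projectivization.ind with | _ v hv =>
    rw [hcorank, hon v hv hp]
    omega
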